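/- Let $M$ be a smooth manifold (Hausdorff, second countable) with a foliation $\mathcal F$, i.e. a smooth distribution $\mathcal F\subset TM$ of constant rank stable under the Lie bracket. Write $\mathfrak X(\mathcal F)$ for the smooth vector fields tangent to $\mathcal F$, $\nu\mathcal F=TM/\mathcal F$ for the normal bundle and $\tau:TM\to\nu\mathcal F$ for the projection; $\mathfrak X(\mathcal F)$ acts on sections of $\nu\mathcal F$ by $\mathcal L_Z\tau(Y)=\tau([Z,Y])$. A *Riemannian metric on* $(M,\mathcal F)$ is a smooth metric $g$ on the vector bundle $\nu\mathcal F$ which is $\mathcal F$-invariant: $$Z\big(g(s,s')\big)=g(\mathcal L_Zs,s')+g(s,\mathcal L_Zs')\qquad\text{for all }Z\in\mathfrak X(\mathcal F)\text{ and all smooth sections }s,s'\text{ of }\nu\mathcal F .$$ $(M,\mathcal F)$ is a *Riemannian foliation* if it admits such a metric. Let $(M,\mathcal F)$ be a Riemannian foliation, let $G$ be a compact Lie group with Lie algebra $\mathfrak g$, and let $\pi:(P,\mathcal F_P)\to(M,\mathcal F)$ be a foliated principal bundle with structure group $G$: $\pi:P\to M$ is a smooth principal $G$-bundle (with right action of $G$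 on $P$), and $\mathcal F_P$ is a $G$-invariant foliation of $P$ such that, for every $p\in P$, $T_p\pi$ restricts to an isomorphism $\mathcal F_P|_p\to\mathcal F|_{\pi(p)}$. For $X\in\mathfrak g$ let $X_P$ be the vector field on $P$ given by $X_P|_p=\frac{d}{dt}\big|_{t=0}\,p\,e^{tX}$. A *connection* on $P$ is a smooth $G$-equivariant $\mathfrak g$-valued $1$-form $\omega$ on $P$ (that is, $R_g^*\omega=\mathrm{Ad}(g^{-1})\omega$ for all $g\in G$) such that $\omega(X_P)=X$ for all $X\in\mathfrak g$; it is *$\mathcal F_P$-basic* if $i(Z)\omega=i(Z)d\omega=0$ for all $Z\in\mathfrak X(\mathcal F_P)$. Then the following two conditions are equivalent: 1. there exists a Riemannian metric on $(P,\mathcal F_P)$, i.e. an $\mathcal F_P$-invariant metric on $\nu\mathcal F_P=TP/\mathcal F_P$; 2. there exists an $\mathcal F_P$-basic connection on $P$. -/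

import Mathlib

open scoped Manifold ContDiff

noncomputable section

/-! ## Vector fields, foliations and transverse metrics

Manifolds are smooth, without boundary, modelled on a finite-dimensional real vector space `E`. -/

section Foliations

variable {E : Type*} [NormedAddCommGroup E] [NormedSpace ℝ E]
  {M : Type*} [TopologicalSpace M] [ChartedSpace E M] [IsManifold 𝓘(ℝ, E) ∞ M]

/-- The (not necessarily continuous) vector field `X` is smooth on the set `U`. -/
def IsSmoothVectorFieldOn (X : ∀ m : M, TangentSpace 𝓘(ℝ, E) m) (U : Set M) : Prop :=
  ContMDiffOn 𝓘(ℝ, E) 𝓘(ℝ, E).tangent ∞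
    (fun m => (⟨m, X m⟩ : TangentBundle 𝓘(ℝ, E) M)) U

/-- The vector field `X` is smooth on the whole manifold. -/
def IsSmoothVectorField (X : ∀ m : M, TangentSpace 𝓘(ℝ, E) m) : Prop :=
  ContMDiff 𝓘(ℝ, E) 𝓘(ℝ, E).tangent ∞
    (fun m => (⟨m, X m⟩ : TangentBundle 𝓘(ℝ, E) M))

/-- The derivative at `m` of a function `f` with values in a normed space `V`, in the direction of
the tangent vector `v`. -/
def dirDeriv {V : Type*} [NormedAddCommGroup V] [NormedSpace ℝ V] (f : M → V) (m : M)
    (v : TangentSpace 𝓘(ℝ, E) m) : V :=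
  mfderiv 𝓘(ℝ, E) 𝓘(ℝ, V) f m v

variable (E M) in
/-- A foliation: a smooth distribution of constant rank which is stable under the Lie bracket. -/
structure SmoothFoliation where
  /-- the subspace of the tangent space at each point -/
  tangent : ∀ m : M, Submodule ℝ (TangentSpace 𝓘(ℝ, E) m)
  /-- the dimension of the leaves -/
  rank : ℕ
  finrank_tangent : ∀ m, Module.finrank ℝ (tangent m) = rank
  exists_frame : ∀ m₀ : M, ∃ U : Set M, IsOpen U ∧ m₀ ∈ U ∧
    ∃ X : Fin rank → ∀ m : M, TangentSpace 𝓘(ℝ, E) m,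
      (∀ i, IsSmoothVectorFieldOn (X i) U) ∧
      ∀ m ∈ U, Submodule.span ℝ (Set.range fun i => X i m) = tangent m
  involutive : ∀ X Y : ∀ m : M, TangentSpace 𝓘(ℝ, E) m,
    IsSmoothVectorField X → IsSmoothVectorField Y →
    (∀ m, X m ∈ tangent m) → (∀ m, Y m ∈ tangent m) →
    ∀ m, VectorField.mlieBracket 𝓘(ℝ, E) X Y m ∈ tangent m

namespace SmoothFoliation

variable (F : SmoothFoliation E M)

/-- `Z` is a smooth vector field tangent to the foliation. -/
def IsTangentField (Z : ∀ m : M, TangentSpace 𝓘(ℝ, E) m) : Prop :=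
  IsSmoothVectorField Z ∧ ∀ m, Z m ∈ F.tangent m

/-- The fibre at `m` of the normal bundle `ν F = TM / F`. -/
abbrev Normal (m : M) : Type _ := TangentSpace 𝓘(ℝ, E) m ⧸ F.tangent m

/-- The projection `τ : TM → ν F` at `m`. -/
def toNormal (m : M) : TangentSpace 𝓘(ℝ, E) m →ₗ[ℝ] F.Normal m := (F.tangent m).mkQ

/-- A Riemannian metric on the normal bundle `ν F`: a smooth family of inner products on the fibres
of `ν F`. The smooth sections of `ν F` are the `τ(X)` for `X` a smooth vector field. -/
structure NormalMetric where
  /-- the bilinear form on each fibre -/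
  form : ∀ m : M, F.Normal m →ₗ[ℝ] F.Normal m →ₗ[ℝ] ℝ
  symm : ∀ m u v, form m u v = form m v u
  pos : ∀ m u, u ≠ 0 → 0 < form m u u
  smooth : ∀ X Y : ∀ m : M, TangentSpace 𝓘(ℝ, E) m,
    IsSmoothVectorField X → IsSmoothVectorField Y →
    ContMDiff 𝓘(ℝ, E) 𝓘(ℝ, ℝ) ∞ fun m => form m (F.toNormal m (X m)) (F.toNormal m (Y m))

/-- The metric `g` on `ν F` is `F`-invariant: `L_Z g = 0` for all vector fields `Z` tangent to `F`,
that is `Z (g(s, s')) = g(L_Z s, s') + g(s, L_Z s')` for all sections `s = τ(X)`, `s' = τ(Y)` of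
`ν F`, where `L_Z τ(X) = τ([Z, X])`. -/
def NormalMetric.IsInvariant {F : SmoothFoliation E M} (g : F.NormalMetric) : Prop :=
  ∀ Z X Y : ∀ m : M, TangentSpace 𝓘(ℝ, E) m,
    F.IsTangentField Z → IsSmoothVectorField X → IsSmoothVectorField Y → ∀ m : M,
    dirDeriv (fun x => g.form x (F.toNormal x (X x)) (F.toNormal x (Y x))) m (Z m) =
      g.form m (F.toNormal m (VectorField.mlieBracket 𝓘(ℝ, E) Z X m)) (F.toNormal m (Y m)) +
      g.form m (F.toNormal m (X m)) (F.toNormal m (VectorField.mlieBracket 𝓘(ℝ, E) Z Y m))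

/-- The foliation admits a transverse Riemannian metric, i.e. an invariant metric on its normal
bundle; in other words it is a Riemannian foliation. -/
def IsRiemannian : Prop := ∃ g : F.NormalMetric, g.IsInvariant

end SmoothFoliation

end Foliations

/-! ## Principal bundles

The structure group `G` acts on the right: the action is written `MulOpposite.op g • p = p · g`. -/

section PrincipalBundles

variable {E : Type*} [NormedAddCommGroup E] [NormedSpace ℝ E]
  {M : Type*} [TopologicalSpace M] [ChartedSpace E M] [IsManifold 𝓘(ℝ, E) ∞ M]
  {EG : Type*} [NormedAddCommGroup EG] [NormedSpace ℝ EG]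
  {G : Type*} [TopologicalSpace G] [ChartedSpace EG G] [Group G]
  {EP : Type*} [NormedAddCommGroup EP] [NormedSpace ℝ EP]
  {P : Type*} [TopologicalSpace P] [ChartedSpace EP P] [IsManifold 𝓘(ℝ, EP) ∞ P]
  [MulAction Gᵐᵒᵖ P]

variable (E EG G EP) in
/-- `π : P → M` is a smooth principal bundle with structure group `G`: `G` acts smoothly on the
right on `P`, preserving the fibres of the smooth map `π`, and around each point of `M` there is a
smooth `G`-equivariant trivialization `π⁻¹(U) ≃ U × G`. -/
structure IsSmoothPrincipalBundle (π : P → M) : Prop where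
  smooth_proj : ContMDiff 𝓘(ℝ, EP) 𝓘(ℝ, E) ∞ π
  smooth_action : ContMDiff (𝓘(ℝ, EP).prod 𝓘(ℝ, EG)) 𝓘(ℝ, EP) ∞
    fun x : P × G => MulOpposite.op x.2 • x.1
  proj_smul : ∀ (p : P) (g : G), π (MulOpposite.op g • p) = π p
  locally_trivial : ∀ m : M, ∃ e : Bundle.Trivialization G π, m ∈ e.baseSet ∧
    ContMDiffOn 𝓘(ℝ, EP) (𝓘(ℝ, E).prod 𝓘(ℝ, EG)) ∞ e e.source ∧
    ContMDiffOn (𝓘(ℝ, E).prod 𝓘(ℝ, EG)) 𝓘(ℝ, EP) ∞ e.toOpenPartialHomeomorph.symm e.target ∧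
    ∀ p ∈ e.source, ∀ g : G, (e (MulOpposite.op g • p)).2 = (e p).2 * g

variable (EP) in
/-- The differential at `p` of the right translation `R_g : P → P`, `p ↦ p · g`. -/
def rightTranslationDeriv (g : G) (p : P) :
    TangentSpace 𝓘(ℝ, EP) p →L[ℝ] TangentSpace 𝓘(ℝ, EP) (MulOpposite.op g • p) :=
  mfderiv 𝓘(ℝ, EP) 𝓘(ℝ, EP) (fun q : P => MulOpposite.op g • q) p

variable (EG G) in
/-- `π : (P, FP) → (M, F)` is a foliated principal bundle: `π` is a principal bundle, the foliation
`FP` is `G`-invariant, and `Tπ` restricts to isomorphisms from `FP` at `p` onto `F` at `π p`. -/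
structure IsFoliatedPrincipalBundle (π : P → M) (FP : SmoothFoliation EP P)
    (F : SmoothFoliation E M) : Prop where
  principal : IsSmoothPrincipalBundle E EG G EP π
  invariant : ∀ (g : G) (p : P), (FP.tangent p).map (rightTranslationDeriv EP g p).toLinearMap =
    FP.tangent (MulOpposite.op g • p)
  bijOn : ∀ p : P, Set.BijOn (mfderiv 𝓘(ℝ, EP) 𝓘(ℝ, E) π p)
    (FP.tangent p : Set (TangentSpace 𝓘(ℝ, EP) p))
    (F.tangent (π p) : Set (TangentSpace 𝓘(ℝ, E) (π p)))

/-- The value at `p` of the vector field `A_P` on `P` generated by an element `A` of the Lie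
algebra `𝔤 = T₁G`: the image of `A` under the differential at `1` of the orbit map `g ↦ p · g`,
i.e. the velocity at `t = 0` of `p · exp(tA)`. -/
def fundamentalField (A : GroupLieAlgebra 𝓘(ℝ, EG) G) (p : P) : TangentSpace 𝓘(ℝ, EP) p :=
  (mfderiv 𝓘(ℝ, EG) 𝓘(ℝ, EP) (fun g : G => MulOpposite.op g • p) 1 A : EP)

/-- The adjoint action of `g` on `𝔤 = T₁G`, the differential at `1` of `h ↦ g h g⁻¹`. -/
def groupAd (g : G) (A : GroupLieAlgebra 𝓘(ℝ, EG) G) : GroupLieAlgebra 𝓘(ℝ, EG) G :=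
  (mfderiv 𝓘(ℝ, EG) 𝓘(ℝ, EG) (fun h : G => g * h * g⁻¹) 1 A : EG)

variable (EG G EP P) in
/-- A principal connection on `P`: a smooth `𝔤`-valued one-form `θ` on `P` which is
`G`-equivariant, `R_g^* θ = Ad(g⁻¹) θ`, and satisfies `θ(A_P) = A` for all `A` in `𝔤`. -/
structure PrincipalConnection where
  /-- the connection form -/
  form : ∀ p : P, TangentSpace 𝓘(ℝ, EP) p →ₗ[ℝ] GroupLieAlgebra 𝓘(ℝ, EG) G
  smooth : ∀ X : ∀ p : P, TangentSpace 𝓘(ℝ, EP) p, IsSmoothVectorField X →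
    ContMDiff (M' := EG) 𝓘(ℝ, EP) 𝓘(ℝ, EG) ∞ fun p => form p (X p)
  equivariant : ∀ (g : G) (p : P) (v : TangentSpace 𝓘(ℝ, EP) p),
    form (MulOpposite.op g • p) (rightTranslationDeriv EP g p v) = groupAd g⁻¹ (form p v)
  fundamental : ∀ (A : GroupLieAlgebra 𝓘(ℝ, EG) G) (p : P), form p (fundamentalField A p) = A

namespace PrincipalConnection

/-- The function `θ(X)` on `P`. The Lie algebra `𝔤 = T₁G` has `EG` as underlying vector space. -/
def eval (θ : PrincipalConnection EG G EP P) (X : ∀ p : P, TangentSpace 𝓘(ℝ, EP) p) (p : P) : EG :=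
  θ.form p (X p)

/-- The exterior derivative of the connection form, evaluated on two vector fields:
`dθ(X, Y) = X(θ(Y)) - Y(θ(X)) - θ([X, Y])`. -/
def extDeriv (θ : PrincipalConnection EG G EP P) (X Y : ∀ p : P, TangentSpace 𝓘(ℝ, EP) p)
    (p : P) : EG :=
  dirDeriv (θ.eval Y) p (X p) - dirDeriv (θ.eval X) p (Y p) -
    θ.eval (VectorField.mlieBracket 𝓘(ℝ, EP) X Y) p

/-- The connection is `FP`-basic: `i(Z)θ = i(Z)dθ = 0` for all vector fields `Z` tangent
to `FP`. -/
def IsBasic (θ : PrincipalConnection EG G EP P) (FP : SmoothFoliation EP P) : Prop :=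
  ∀ Z : ∀ p : P, TangentSpace 𝓘(ℝ, EP) p, FP.IsTangentField Z →
    (∀ p, θ.eval Z p = 0) ∧
    ∀ Y : ∀ p : P, TangentSpace 𝓘(ℝ, EP) p, IsSmoothVectorField Y → ∀ p, θ.extDeriv Z Y p = 0

end PrincipalConnection

end PrincipalBundles

end

/-! From a metric to a connection. As `Tπ` is injective on `FP`, a vertical vector lying in `FP` is
zero. Hence `A ↦ A_P(p)` embeds `𝔤` in the normal space at `p`, and orthogonal projection onto the
image gives a `𝔤`-valued one-form `β` (`basicForm`) which reproduces `A` on `A_P` and kills `FP`.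
For `Z` tangent to `FP` the bracket `[Z, A_P]` is again tangent to `FP`, because `FP` is
`G`-invariant (`mlieBracket_fundamentalField_mem`). Invariance of the metric then makes the Gram
form of the fundamental fields constant along `Z` and yields `L_Z β = 0`
(`IsInvariant.dirDeriv_basicForm`). What `β` may lack is equivariance. It is obtained by averaging:
`θ = ∫ Ad(g) R_g^* β dg` over the Haar probability measure of the compact group `G`. Left invariance
of the measure makes `θ` equivariant, and each integrand keeps the other properties of `β` because
`R_g` preserves `FP` and brackets.

From a connection to a metric. Let `g` be an invariant metric on the base and `θ` a basic
connection. The form `π^* g + ⟨θ, θ⟩`, for any fixed inner product on `𝔤`, is positive semidefinite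
with kernel exactly `FP`, so it descends to a metric on the normal bundle. The second summand is
invariant since `L_Z θ = 0`. The first needs care, since a field `Z` tangent to `FP` need not be
projectable to the base: `IsInvariant.lieDeriv_pullback` compares it at one point with a field
tangent to `F` having the same value there.

No flows are used. Tensors are written in a chart as operator-valued functions, and Lie derivatives
are computed by the product rule together with the identity `[X, Y]u = X(Yu) - Y(Xu)` for
vector-valued functions (`dirDeriv_mlieBracket`). -/

open VectorField Filter Topology

set_option linter.unusedSectionVars false

noncomputable section

/-! ### Extension of local vector fields and of single vectors to global fields -/

section LocalExtension

variable {E : Type*} [NormedAddCommGroup E] [NormedSpace ℝ E] [FiniteDimensional ℝ E]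
  {M : Type*} [TopologicalSpace M] [T2Space M] [ChartedSpace E M] [IsManifold 𝓘(ℝ, E) ∞ M]

/-- Smoothness and invariance of forms and metrics are tested on global fields only, so local fields
are cut off by a bump function supported in `U`. That the cutoff equals 1 on a neighbourhood, not
merely at `m₀`, keeps a local frame unchanged near `m₀`. -/
theorem exists_bump_smul_isSmoothVectorField {X : ∀ m : M, TangentSpace 𝓘(ℝ, E) m} {U : Set M}
    (hU : IsOpen U) {m₀ : M} (hm : m₀ ∈ U) (hX : IsSmoothVectorFieldOn X U) :
    ∃ f : M → ℝ, f =ᶠ[𝓝 m₀] 1 ∧ (∀ m, m ∉ U → f m = 0) ∧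
      IsSmoothVectorField (fun m => f m • X m) := by
  obtain ⟨f, -, hf⟩ := (SmoothBumpFunction.nhds_basis_tsupport (I := 𝓘(ℝ, E)) m₀).mem_iff.1
    (hU.mem_nhds hm)
  refine ⟨f, f.eventuallyEq_one, fun m hm => ?_, ?_⟩
  · by_contra h
    exact hm (hf (subset_tsupport _ h))
  · exact ContMDiffOn.smul_section_of_tsupport (f.contMDiff.contMDiffOn) hU hf hX

/-- The vector field on a chart domain which is constant in that chart. -/
def chartField (m₀ : M) (u : E) (m : M) : TangentSpace 𝓘(ℝ, E) m :=
  (trivializationAt E (TangentSpace 𝓘(ℝ, E)) m₀).symm m u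

theorem isSmoothVectorFieldOn_chartField (m₀ : M) (u : E) :
    IsSmoothVectorFieldOn (chartField m₀ u) (chartAt E m₀).source := by
  intro m hm
  refine ContMDiffAt.contMDiffWithinAt ?_
  rw [(trivializationAt E (TangentSpace 𝓘(ℝ, E)) m₀).contMDiffAt_iff (n := ∞) (by simpa using hm)]
  refine ⟨contMDiffAt_id, ?_⟩
  refine (contMDiffAt_const (c := u)).congr_of_eventuallyEq ?_
  filter_upwards [(chartAt E m₀).open_source.mem_nhds hm] with m' hm'
  simp only [chartField]
  rw [Bundle.Trivialization.apply_mk_symm _ (by simpa using hm')]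

theorem dirDeriv_extChartAt {m₀ m : M} (hm : m ∈ (chartAt E m₀).source)
    (v : TangentSpace 𝓘(ℝ, E) m) :
    dirDeriv (extChartAt 𝓘(ℝ, E) m₀) m v =
      (trivializationAt E (TangentSpace 𝓘(ℝ, E)) m₀ ⟨m, v⟩).2 := by
  have h := TangentBundle.continuousLinearMapAt_trivializationAt (I := 𝓘(ℝ, E)) hm
  have h2 : (trivializationAt E (TangentSpace 𝓘(ℝ, E)) m₀).continuousLinearMapAt ℝ m v =
      (trivializationAt E (TangentSpace 𝓘(ℝ, E)) m₀ ⟨m, v⟩).2 := by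
    rw [Bundle.Trivialization.continuousLinearMapAt_apply,
      Bundle.Trivialization.coe_linearMapAt_of_mem _ (by simpa using hm)]
  rw [← h2]
  exact (DFunLike.congr_fun h v).symm

theorem dirDeriv_extChartAt_chartField {m₀ m : M} (hm : m ∈ (chartAt E m₀).source) (u : E) :
    dirDeriv (extChartAt 𝓘(ℝ, E) m₀) m (chartField m₀ u m) = u := by
  rw [dirDeriv_extChartAt hm, chartField, Bundle.Trivialization.apply_mk_symm _ (by simpa using hm)]

theorem chartField_dirDeriv_extChartAt {m₀ m : M} (hm : m ∈ (chartAt E m₀).source)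
    (v : TangentSpace 𝓘(ℝ, E) m) :
    chartField m₀ (dirDeriv (extChartAt 𝓘(ℝ, E) m₀) m v) m = v := by
  rw [dirDeriv_extChartAt hm]
  exact Bundle.Trivialization.symm_apply_apply_mk _ (by simpa using hm) v

theorem chartField_sum {m₀ m : M} (hm : m ∈ (chartAt E m₀).source) {ι : Type*} [Fintype ι]
    (c : ι → ℝ) (u : ι → E) :
    chartField m₀ (∑ i, c i • u i) m = ∑ i, c i • chartField m₀ (u i) m := by
  have : ∀ u, chartField m₀ u m =
      (trivializationAt E (TangentSpace 𝓘(ℝ, E)) m₀).symmL ℝ m u :=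
    fun u => (Bundle.Trivialization.symmL_apply _ (by simpa using hm) u).symm
  simp only [this, map_sum, map_smul]

/-- Around each point there are global smooth vector fields forming a frame, in which the
coefficients of a vector are its coordinates in the chart. -/
theorem exists_chartFrame (m₀ : M) :
    ∃ e : Fin (Module.finrank ℝ E) → ∀ m : M, TangentSpace 𝓘(ℝ, E) m,
      (∀ i, IsSmoothVectorField (e i)) ∧ ∀ᶠ m in 𝓝 m₀, ∀ v : TangentSpace 𝓘(ℝ, E) m,
        v = ∑ i, (Module.finBasis ℝ E).repr
          (dirDeriv (extChartAt 𝓘(ℝ, E) m₀) m v) i • e i m := by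
  choose f hf _ hs using fun i => exists_bump_smul_isSmoothVectorField
    (chartAt E m₀).open_source (mem_chart_source E m₀)
    (isSmoothVectorFieldOn_chartField m₀ (Module.finBasis ℝ E i))
  refine ⟨_, hs, ?_⟩
  filter_upwards [eventually_all.2 hf, (chartAt E m₀).open_source.mem_nhds (mem_chart_source E m₀)]
    with m h1 hm v
  simp only [h1, Pi.one_apply, one_smul]
  conv_lhs => rw [← chartField_dirDeriv_extChartAt hm v]
  rw [← chartField_sum hm, (Module.finBasis ℝ E).sum_repr]

theorem exists_isSmoothVectorField_eq {m₀ : M} (v : TangentSpace 𝓘(ℝ, E) m₀) :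
    ∃ X : ∀ m : M, TangentSpace 𝓘(ℝ, E) m, IsSmoothVectorField X ∧ X m₀ = v := by
  obtain ⟨f, h1, -, hs⟩ := exists_bump_smul_isSmoothVectorField
    (chartAt E m₀).open_source (mem_chart_source E m₀)
    (isSmoothVectorFieldOn_chartField m₀ (dirDeriv (extChartAt 𝓘(ℝ, E) m₀) m₀ v))
  refine ⟨_, hs, ?_⟩
  rw [h1.self_of_nhds, Pi.one_apply, one_smul]
  exact chartField_dirDeriv_extChartAt (mem_chart_source E m₀) v

/-- A constant-coefficient combination of a local frame is cut off; outside the frame's domain the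
result is zero, hence still tangent. This turns hypotheses on tangent fields into statements about
single tangent vectors. -/
theorem SmoothFoliation.exists_isTangentField_eq (F : SmoothFoliation E M) {m₀ : M}
    {v : TangentSpace 𝓘(ℝ, E) m₀} (hv : v ∈ F.tangent m₀) :
    ∃ Z : ∀ m : M, TangentSpace 𝓘(ℝ, E) m, F.IsTangentField Z ∧ Z m₀ = v := by
  obtain ⟨U, hU, hm, X, hX, hspan⟩ := F.exists_frame m₀
  rw [← hspan m₀ hm, Submodule.mem_span_range_iff_exists_fun] at hv
  obtain ⟨c, hc⟩ := hv
  have hX' : IsSmoothVectorFieldOn (fun m => ∑ i, c i • X i m) U :=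
    ContMDiffOn.sum_section fun i _ => ContMDiffOn.const_smul_section (hX i)
  obtain ⟨f, h1, h0, hs⟩ := exists_bump_smul_isSmoothVectorField hU hm hX'
  refine ⟨_, ⟨hs, fun m => ?_⟩, ?_⟩
  · by_cases hmU : m ∈ U
    · refine Submodule.smul_mem _ _ (Submodule.sum_mem _ fun i _ => Submodule.smul_mem _ _ ?_)
      rw [← hspan m hmU]
      exact Submodule.subset_span ⟨i, rfl⟩
    · simp only [h0 m hmU, zero_smul]
      exact Submodule.zero_mem _
  · rw [h1.self_of_nhds, Pi.one_apply, one_smul]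
    exact hc

end LocalExtension

/-! ### Coordinate expressions of tensors -/

section TensorsInCharts

variable {E : Type*} [NormedAddCommGroup E] [NormedSpace ℝ E] [FiniteDimensional ℝ E]
  {M : Type*} [TopologicalSpace M] [T2Space M] [ChartedSpace E M] [IsManifold 𝓘(ℝ, E) ∞ M]
  {V : Type*} [NormedAddCommGroup V] [NormedSpace ℝ V]

/-- A fibrewise linear form is determined by its values on a frame, and these are smooth by
hypothesis. The gain is an operator-valued function `b` on a fixed vector space, to which the
product rule applies. -/
theorem exists_chart_linearForm (β : ∀ m : M, TangentSpace 𝓘(ℝ, E) m →ₗ[ℝ] V)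
    (hβ : ∀ X : ∀ m : M, TangentSpace 𝓘(ℝ, E) m, IsSmoothVectorField X →
      ContMDiff 𝓘(ℝ, E) 𝓘(ℝ, V) ∞ fun m => β m (X m)) (m₀ : M) :
    ∃ b : M → E →L[ℝ] V, ContMDiffAt 𝓘(ℝ, E) 𝓘(ℝ, E →L[ℝ] V) ∞ b m₀ ∧
      ∀ᶠ m in 𝓝 m₀, ∀ v, β m v =
        b m (dirDeriv (extChartAt 𝓘(ℝ, E) m₀) m v) := by
  obtain ⟨e, he, hev⟩ := exists_chartFrame (E := E) m₀
  let c : Fin (Module.finrank ℝ E) → E →L[ℝ] ℝ := fun i =>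
    LinearMap.toContinuousLinearMap ((Module.finBasis ℝ E).coord i)
  refine ⟨fun m => ∑ i, ContinuousLinearMap.smulRightL ℝ E V (c i) (β m (e i m)), ?_, ?_⟩
  · refine contMDiffAt_finsetSum fun i _ => ?_
    exact (ContinuousLinearMap.contMDiff _).contMDiffAt.comp m₀ (hβ _ (he i)).contMDiffAt
  · filter_upwards [hev] with m hm v
    conv_lhs => rw [hm v]
    rw [map_sum]
    simp only [FunLike.coe_sum, Finset.sum_apply, map_smul]
    rfl

theorem exists_chart_bilinForm
    (h : ∀ m : M, TangentSpace 𝓘(ℝ, E) m →ₗ[ℝ] TangentSpace 𝓘(ℝ, E) m →ₗ[ℝ] ℝ)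
    (hh : ∀ X Y : ∀ m : M, TangentSpace 𝓘(ℝ, E) m, IsSmoothVectorField X →
      IsSmoothVectorField Y → ContMDiff 𝓘(ℝ, E) 𝓘(ℝ, ℝ) ∞ fun m => h m (X m) (Y m)) (m₀ : M) :
    ∃ H : M → E →L[ℝ] E →L[ℝ] ℝ, ContMDiffAt 𝓘(ℝ, E) 𝓘(ℝ, E →L[ℝ] E →L[ℝ] ℝ) ∞ H m₀ ∧
      ∀ᶠ m in 𝓝 m₀, ∀ v w, h m v w =
        H m (dirDeriv (extChartAt 𝓘(ℝ, E) m₀) m v)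
          (dirDeriv (extChartAt 𝓘(ℝ, E) m₀) m w) := by
  obtain ⟨e, he, hev⟩ := exists_chartFrame (E := E) m₀
  let c : Fin (Module.finrank ℝ E) → E →L[ℝ] ℝ := fun i =>
    LinearMap.toContinuousLinearMap ((Module.finBasis ℝ E).coord i)
  refine ⟨fun m => ∑ i, ∑ j, h m (e i m) (e j m) • (c i).smulRight (c j), ?_, ?_⟩
  · refine contMDiffAt_finsetSum fun i _ => contMDiffAt_finsetSum fun j _ => ?_
    exact (hh _ _ (he i) (he j)).contMDiffAt.smul contMDiffAt_const
  · filter_upwards [hev] with m hm v w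
    conv_lhs => rw [hm v, hm w]
    rw [LinearMap.map_sum₂]
    simp only [FunLike.coe_sum, Finset.sum_apply, map_smul, map_sum,
      LinearMap.smul_apply,
      smul_apply, ContinuousLinearMap.smulRight_apply, smul_eq_mul]
    refine Finset.sum_congr rfl fun i _ => Finset.sum_congr rfl fun j _ => ?_
    have : ∀ i u, c i u = (Module.finBasis ℝ E).repr u i := fun i u => rfl
    rw [this, this]
    ring

end TensorsInCharts

/-! ### Smoothness of partial derivatives depending on parameters -/

section PartialDerivatives

variable {EN : Type*} [NormedAddCommGroup EN] [NormedSpace ℝ EN]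
  {HN : Type*} [TopologicalSpace HN] {J : ModelWithCorners ℝ EN HN}
  {N : Type*} [TopologicalSpace N] [ChartedSpace HN N] [IsManifold J ∞ N]
  {E : Type*} [NormedAddCommGroup E] [NormedSpace ℝ E]
  {H : Type*} [TopologicalSpace H] {I : ModelWithCorners ℝ E H}
  {M : Type*} [TopologicalSpace M] [ChartedSpace H M] [IsManifold I ∞ M]
  {E' : Type*} [NormedAddCommGroup E'] [NormedSpace ℝ E']
  {H' : Type*} [TopologicalSpace H'] {I' : ModelWithCorners ℝ E' H'}
  {M' : Type*} [TopologicalSpace M'] [ChartedSpace H' M'] [IsManifold I' ∞ M']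

/-- The partial derivative of a smooth map in the direction of a smooth family of tangent vectors
is a smooth family of tangent vectors. -/
theorem ContMDiffAt.mfderiv_apply_tangentBundle {f : N → M → M'} {g : N → M}
    {v : ∀ n, TangentSpace I (g n)} {n₀ : N}
    (hf : ContMDiffAt (J.prod I) I' ∞ (Function.uncurry f) (n₀, g n₀))
    (hv : ContMDiffAt J I.tangent ∞ (fun n => (⟨g n, v n⟩ : TangentBundle I M)) n₀) :
    ContMDiffAt J I'.tangent ∞
      (fun n => (⟨f n (g n), mfderiv I I' (f n) (g n) (v n)⟩ : TangentBundle I' M')) n₀ := by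
  have : IsManifold I 1 M := .of_le (n := ∞) (by simp)
  have : IsManifold I' 1 M' := .of_le (n := ∞) (by simp)
  have : IsManifold J 1 N := .of_le (n := ∞) (by simp)
  have hg : ContMDiffAt J I ∞ g n₀ :=
    (Bundle.contMDiff_proj (TangentSpace I)).contMDiffAt.comp n₀ hv
  have hφ := ContMDiffAt.mfderiv (m := ∞) f g hf hg (by simp)
  have hb : ContMDiffAt J I' ∞ (fun n => f n (g n)) n₀ :=
    hf.comp n₀ (contMDiffAt_id.prodMk hg)
  exact ContMDiffAt.clm_apply_of_inCoordinates hφ hv hb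

/-- The partial derivative of a smooth vector-valued function in the direction of a smooth family
of tangent vectors is smooth. -/
theorem ContMDiffAt.mfderiv_apply_vectorSpace {V : Type*} [NormedAddCommGroup V] [NormedSpace ℝ V]
    {f : N → M → V} {g : N → M} {v : ∀ n, TangentSpace I (g n)} {n₀ : N}
    (hf : ContMDiffAt (J.prod I) 𝓘(ℝ, V) ∞ (Function.uncurry f) (n₀, g n₀))
    (hv : ContMDiffAt J I.tangent ∞ (fun n => (⟨g n, v n⟩ : TangentBundle I M)) n₀) :
    ContMDiffAt J 𝓘(ℝ, V) ∞ (fun n => (mfderiv I 𝓘(ℝ, V) (f n) (g n) (v n) : V)) n₀ :=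
  (contMDiff_snd_tangentBundle_modelSpace V 𝓘(ℝ, V)).contMDiffAt.comp n₀
    (hf.mfderiv_apply_tangentBundle hv)

theorem TangentBundle.mk_congr {p q : M} (h : p = q) (v : E) :
    (⟨p, v⟩ : TangentBundle I M) = ⟨q, v⟩ := by
  subst h; rfl

end PartialDerivatives

/-! ### Calculus of directional derivatives -/

section DirectionalDerivatives

variable {E : Type*} [NormedAddCommGroup E] [NormedSpace ℝ E]
  {M : Type*} [TopologicalSpace M] [ChartedSpace E M]
  {E' : Type*} [NormedAddCommGroup E'] [NormedSpace ℝ E']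
  {M' : Type*} [TopologicalSpace M'] [ChartedSpace E' M']
  {V W W' : Type*} [NormedAddCommGroup V] [NormedSpace ℝ V] [NormedAddCommGroup W] [NormedSpace ℝ W]
  [NormedAddCommGroup W'] [NormedSpace ℝ W']
  {m : M}

theorem dirDeriv_const (c : V) (v : TangentSpace 𝓘(ℝ, E) m) :
    dirDeriv (fun _ : M => c) m v = 0 := by
  rw [dirDeriv, mfderiv_const]; rfl

theorem Filter.EventuallyEq.dirDeriv_eq {f g : M → V} (h : f =ᶠ[𝓝 m] g)
    (v : TangentSpace 𝓘(ℝ, E) m) : dirDeriv f m v = dirDeriv g m v := by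
  rw [dirDeriv, dirDeriv, h.mfderiv_eq]; rfl

theorem dirDeriv_eq_zero {f : M → V} (h : ∀ᶠ x in 𝓝 m, f x = 0)
    (v : TangentSpace 𝓘(ℝ, E) m) : dirDeriv f m v = 0 := by
  rw [Filter.EventuallyEq.dirDeriv_eq (g := fun _ => 0) h, dirDeriv_const]

theorem dirDeriv_comp {f : M → M'} {u : M' → V} (hu : MDifferentiableAt 𝓘(ℝ, E') 𝓘(ℝ, V) u (f m))
    (hf : MDifferentiableAt 𝓘(ℝ, E) 𝓘(ℝ, E') f m) (v : TangentSpace 𝓘(ℝ, E) m) :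
    dirDeriv (fun x => u (f x)) m v =
      dirDeriv u (f m) (mfderiv 𝓘(ℝ, E) 𝓘(ℝ, E') f m v) := by
  rw [dirDeriv, dirDeriv, show (fun x => u (f x)) = u ∘ f from rfl, mfderiv_comp m hu hf]
  rfl

theorem dirDeriv_clm (L : V →L[ℝ] W) {f : M → V} (hf : MDifferentiableAt 𝓘(ℝ, E) 𝓘(ℝ, V) f m)
    (v : TangentSpace 𝓘(ℝ, E) m) :
    dirDeriv (fun x => L (f x)) m v = L (dirDeriv f m v) := by
  rw [dirDeriv_comp (L.differentiableAt.mdifferentiableAt) hf, dirDeriv, mfderiv_eq_fderiv,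
    L.fderiv]
  rfl

theorem dirDeriv_sub {f g : M → V} (hf : MDifferentiableAt 𝓘(ℝ, E) 𝓘(ℝ, V) f m)
    (hg : MDifferentiableAt 𝓘(ℝ, E) 𝓘(ℝ, V) g m) (v : TangentSpace 𝓘(ℝ, E) m) :
    dirDeriv (fun x => f x - g x) m v = dirDeriv f m v - dirDeriv g m v := by
  have := (hf.hasMFDerivAt.sub hg.hasMFDerivAt).mfderiv
  rw [dirDeriv, show (fun x => f x - g x) = f - g from rfl, this]; rfl

theorem dirDeriv_add {f g : M → V} (hf : MDifferentiableAt 𝓘(ℝ, E) 𝓘(ℝ, V) f m)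
    (hg : MDifferentiableAt 𝓘(ℝ, E) 𝓘(ℝ, V) g m) (v : TangentSpace 𝓘(ℝ, E) m) :
    dirDeriv (fun x => f x + g x) m v = dirDeriv f m v + dirDeriv g m v := by
  have := (hf.hasMFDerivAt.add hg.hasMFDerivAt).mfderiv
  rw [dirDeriv, show (fun x => f x + g x) = f + g from rfl, this]; rfl

theorem dirDeriv_bilin (B : V →L[ℝ] W →L[ℝ] W') {f : M → V} {g : M → W}
    (hf : MDifferentiableAt 𝓘(ℝ, E) 𝓘(ℝ, V) f m)
    (hg : MDifferentiableAt 𝓘(ℝ, E) 𝓘(ℝ, W) g m) (v : TangentSpace 𝓘(ℝ, E) m) :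
    dirDeriv (fun x => B (f x) (g x)) m v =
      B (dirDeriv f m v) (g m) + B (f m) (dirDeriv g m v) := by
  have hB : DifferentiableAt ℝ (fun p : V × W => B p.1 p.2) (f m, g m) :=
    B.isBoundedBilinearMap.differentiableAt _
  have hfg : MDifferentiableAt 𝓘(ℝ, E) 𝓘(ℝ, V × W) (fun x => (f x, g x)) m :=
    hf.prodMk_space hg
  rw [dirDeriv_comp (u := fun p : V × W => B p.1 p.2) (f := fun x => (f x, g x))
    hB.mdifferentiableAt hfg]
  have h1 := B.isBoundedBilinearMap.fderiv (f m, g m)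
  rw [dirDeriv, mfderiv_eq_fderiv]
  have h2 : (mfderiv 𝓘(ℝ, E) 𝓘(ℝ, V × W) (fun x => (f x, g x)) m v : V × W) =
      (dirDeriv f m v, dirDeriv g m v) := by
    exact Prod.ext (dirDeriv_clm (ContinuousLinearMap.fst ℝ V W) hfg v).symm
      (dirDeriv_clm (ContinuousLinearMap.snd ℝ V W) hfg v).symm
  refine (congrArg (fderiv ℝ (fun p : V × W => B p.1 p.2) (f m, g m)) h2).trans ?_
  rw [h1]
  simp [IsBoundedBilinearMap.deriv, add_comm]

theorem dirDeriv_clm_apply {L : M → V →L[ℝ] W} {g : M → V}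
    (hL : MDifferentiableAt 𝓘(ℝ, E) 𝓘(ℝ, V →L[ℝ] W) L m)
    (hg : MDifferentiableAt 𝓘(ℝ, E) 𝓘(ℝ, V) g m) (v : TangentSpace 𝓘(ℝ, E) m) :
    dirDeriv (fun x => L x (g x)) m v = dirDeriv L m v (g m) + L m (dirDeriv g m v) :=
  dirDeriv_bilin (ContinuousLinearMap.id ℝ (V →L[ℝ] W)) hL hg v

variable [IsManifold 𝓘(ℝ, E) ∞ M] in
theorem ContMDiffAt.dirDeriv {f : M → V} {X : ∀ m : M, TangentSpace 𝓘(ℝ, E) m}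
    (hf : ContMDiffAt 𝓘(ℝ, E) 𝓘(ℝ, V) ∞ f m) (hX : IsSmoothVectorField X) :
    ContMDiffAt 𝓘(ℝ, E) 𝓘(ℝ, V) ∞ (fun x => dirDeriv f x (X x)) m :=
  ContMDiffAt.mfderiv_apply_vectorSpace (N := M) (f := fun _ => f) (g := id) (v := X)
    (hf.comp (m, m) contMDiffAt_snd) hX.contMDiffAt

end DirectionalDerivatives


/-! ### The Lie bracket as a commutator of derivations -/

section Bracket

variable {E : Type*} [NormedAddCommGroup E] [NormedSpace ℝ E]
  {M : Type*} [TopologicalSpace M] [ChartedSpace E M] [IsManifold 𝓘(ℝ, E) ∞ M]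
  {V : Type*} [NormedAddCommGroup V] [NormedSpace ℝ V] {m : M}

theorem dirDeriv_eq_fderiv_extChartAt (m₀ : M) {u : M → V} (hm : m ∈ (extChartAt 𝓘(ℝ, E) m₀).source)
    (hu : MDifferentiableAt 𝓘(ℝ, E) 𝓘(ℝ, V) u m) (v : TangentSpace 𝓘(ℝ, E) m) :
    dirDeriv u m v = fderiv ℝ (u ∘ (extChartAt 𝓘(ℝ, E) m₀).symm) (extChartAt 𝓘(ℝ, E) m₀ m)
      (dirDeriv (extChartAt 𝓘(ℝ, E) m₀) m v) := by
  have : IsManifold 𝓘(ℝ, E) 1 M := .of_le (n := ∞) (by simp)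
  have hφ : MDifferentiableAt 𝓘(ℝ, E) 𝓘(ℝ, E) (extChartAt 𝓘(ℝ, E) m₀) m :=
    mdifferentiableAt_extChartAt (by simpa using hm)
  have hu' : MDifferentiableAt 𝓘(ℝ, E) 𝓘(ℝ, V) (u ∘ (extChartAt 𝓘(ℝ, E) m₀).symm)
      (extChartAt 𝓘(ℝ, E) m₀ m) := by
    have h1 : MDifferentiableAt 𝓘(ℝ, E) 𝓘(ℝ, E) (extChartAt 𝓘(ℝ, E) m₀).symm
        (extChartAt 𝓘(ℝ, E) m₀ m) := by
      have := mdifferentiableWithinAt_extChartAt_symm (I := 𝓘(ℝ, E))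
        ((extChartAt 𝓘(ℝ, E) m₀).map_source hm)
      simpa [mdifferentiableWithinAt_univ] using this
    refine MDifferentiableAt.comp (I' := 𝓘(ℝ, E)) _ ?_ h1
    rwa [(extChartAt 𝓘(ℝ, E) m₀).left_inv hm]
  have h : u =ᶠ[𝓝 m] fun x => (u ∘ (extChartAt 𝓘(ℝ, E) m₀).symm) (extChartAt 𝓘(ℝ, E) m₀ x) := by
    filter_upwards [(isOpen_extChartAt_source m₀).mem_nhds hm] with x hx
    simp only [Function.comp_apply]
    rw [(extChartAt 𝓘(ℝ, E) m₀).left_inv hx]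
  rw [h.dirDeriv_eq, dirDeriv_comp hu' hφ, dirDeriv, mfderiv_eq_fderiv]
  rfl

/-- The bracket on a manifold is computed by pulling both fields back along the inverse chart. On
the chart target, inverting the derivative of the inverse chart gives the derivative of the chart,
whence the coordinate fields on the right. -/
theorem dirDeriv_extChartAt_mlieBracket (X Y : ∀ m : M, TangentSpace 𝓘(ℝ, E) m) (m₀ : M) :
    dirDeriv (extChartAt 𝓘(ℝ, E) m₀) m₀ (mlieBracket 𝓘(ℝ, E) X Y m₀) =
      lieBracket ℝ
        (fun x => dirDeriv (extChartAt 𝓘(ℝ, E) m₀) ((extChartAt 𝓘(ℝ, E) m₀).symm x)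
          (X ((extChartAt 𝓘(ℝ, E) m₀).symm x)))
        (fun x => dirDeriv (extChartAt 𝓘(ℝ, E) m₀) ((extChartAt 𝓘(ℝ, E) m₀).symm x)
          (Y ((extChartAt 𝓘(ℝ, E) m₀).symm x))) (extChartAt 𝓘(ℝ, E) m₀ m₀) := by
  have : IsManifold 𝓘(ℝ, E) 1 M := .of_le (n := ∞) (by simp)
  have key : ∀ X : ∀ m : M, TangentSpace 𝓘(ℝ, E) m,
      mpullbackWithin 𝓘(ℝ, E) 𝓘(ℝ, E) (extChartAt 𝓘(ℝ, E) m₀).symm X (Set.range 𝓘(ℝ, E))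
      =ᶠ[𝓝 (extChartAt 𝓘(ℝ, E) m₀ m₀)]
      fun x => dirDeriv (extChartAt 𝓘(ℝ, E) m₀) ((extChartAt 𝓘(ℝ, E) m₀).symm x)
          (X ((extChartAt 𝓘(ℝ, E) m₀).symm x)) := by
    intro X
    filter_upwards [(isOpen_extChartAt_target m₀).mem_nhds (mem_extChartAt_target m₀)] with x hx
    have h1 := mfderiv_extChartAt_comp_mfderivWithin_extChartAt_symm (I := 𝓘(ℝ, E)) hx
    have h2 := mfderivWithin_extChartAt_symm_comp_mfderiv_extChartAt (I := 𝓘(ℝ, E)) hx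
    rw [mpullbackWithin_apply, ContinuousLinearMap.inverse_eq h2 h1]
    rfl
  rw [← mlieBracketWithin_univ, mlieBracketWithin_apply]
  have hinv := isInvertible_mfderiv_extChartAt (I := 𝓘(ℝ, E))
    (mem_extChartAt_source (I := 𝓘(ℝ, E)) m₀)
  refine (hinv.self_apply_inverse _).trans ?_
  have hset : (extChartAt 𝓘(ℝ, E) m₀).symm ⁻¹' Set.univ ∩ Set.range 𝓘(ℝ, E) = Set.univ := by simp
  rw [hset]
  refine (congrFun (lieBracketWithin_univ (𝕜 := ℝ) (E := E)) _).trans ?_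
  exact Filter.EventuallyEq.lieBracket_vectorField_eq (𝕜 := ℝ) (E := E) (key X) (key Y)

theorem ContMDiffAt.contDiffAt_comp_extChartAt_symm {u : M → V}
    (hu : ContMDiffAt 𝓘(ℝ, E) 𝓘(ℝ, V) ∞ u m) :
    ContDiffAt ℝ ∞ (u ∘ (extChartAt 𝓘(ℝ, E) m).symm) (extChartAt 𝓘(ℝ, E) m m) := by
  have hsymm := (contMDiffOn_extChartAt_symm (I := 𝓘(ℝ, E)) (n := ∞) m).contMDiffAt
    ((isOpen_extChartAt_target m).mem_nhds (mem_extChartAt_target m))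
  refine ContMDiffAt.contDiffAt (ContMDiffAt.comp (I' := 𝓘(ℝ, E)) _ ?_ hsymm)
  rwa [extChartAt_to_inv]

/-- The Lie bracket of vector fields is their commutator as derivations. -/
theorem dirDeriv_mlieBracket {u : M → V} {X Y : ∀ m : M, TangentSpace 𝓘(ℝ, E) m}
    (hu : ContMDiffAt 𝓘(ℝ, E) 𝓘(ℝ, V) ∞ u m)
    (hX : IsSmoothVectorField X) (hY : IsSmoothVectorField Y) :
    dirDeriv u m (mlieBracket 𝓘(ℝ, E) X Y m) =
      dirDeriv (fun x => dirDeriv u x (Y x)) m (X m) -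
        dirDeriv (fun x => dirDeriv u x (X x)) m (Y m) := by
  set φ := extChartAt 𝓘(ℝ, E) m with hφ
  have hms : m ∈ φ.source := mem_extChartAt_source m
  have hsymm : ContMDiffAt 𝓘(ℝ, E) 𝓘(ℝ, E) ∞ φ.symm (φ m) := by
    have := contMDiffOn_extChartAt_symm (I := 𝓘(ℝ, E)) (n := ∞) m
    exact this.contMDiffAt ((isOpen_extChartAt_target m).mem_nhds (mem_extChartAt_target m))
  have hleft : φ.symm (φ m) = m := φ.left_inv hms
  set û := u ∘ φ.symm with hû
  have hûs : ContDiffAt ℝ ∞ û (φ m) := hu.contDiffAt_comp_extChartAt_symm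
  have hφs : ContMDiffAt 𝓘(ℝ, E) 𝓘(ℝ, E) ∞ φ m := contMDiffAt_extChartAt
  set X' : E → E := fun x => dirDeriv φ (φ.symm x) (X (φ.symm x)) with hX'
  set Y' : E → E := fun x => dirDeriv φ (φ.symm x) (Y (φ.symm x)) with hY'
  have hX's : ContDiffAt ℝ ∞ X' (φ m) := (hφs.dirDeriv hX).contDiffAt_comp_extChartAt_symm
  have hY's : ContDiffAt ℝ ∞ Y' (φ m) := (hφs.dirDeriv hY).contDiffAt_comp_extChartAt_symm
  have hd : ∀ᶠ x in 𝓝 (φ m), x ∈ φ.target ∧ MDifferentiableAt 𝓘(ℝ, E) 𝓘(ℝ, V) u (φ.symm x) := by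
    have h1 : ∀ᶠ y in 𝓝 m, MDifferentiableAt 𝓘(ℝ, E) 𝓘(ℝ, V) u y := by
      filter_upwards [(contMDiffAt_iff_contMDiffAt_nhds (by simp)).1 (hu.of_le (m := 1) (by simp))]
        with y hy
      exact hy.mdifferentiableAt (by simp)
    rw [← hleft] at h1
    exact ((isOpen_extChartAt_target m).eventually_mem (mem_extChartAt_target m)).and
      (hsymm.continuousAt.eventually h1)
  have inner : ∀ Z : ∀ m : M, TangentSpace 𝓘(ℝ, E) m,
      (fun x => dirDeriv u x (Z x)) ∘ φ.symm =ᶠ[𝓝 (φ m)]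
        fun x => fderiv ℝ û x (dirDeriv φ (φ.symm x) (Z (φ.symm x))) := by
    intro Z
    filter_upwards [hd] with x hx
    simp only [Function.comp_apply]
    rw [dirDeriv_eq_fderiv_extChartAt m (φ.map_target hx.1) hx.2, ← hφ, φ.right_inv hx.1]
  have hfd : DifferentiableAt ℝ (fderiv ℝ û) (φ m) :=
    ((hûs.fderiv_right (m := 1) (by norm_cast)).differentiableAt (by simp))
  have hdX := hX's.differentiableAt (by simp)
  have hdY := hY's.differentiableAt (by simp)
  have XX : dirDeriv φ m (X m) = X' (φ m) := by simp only [hX']; rw [hleft]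
  have YY : dirDeriv φ m (Y m) = Y' (φ m) := by simp only [hY']; rw [hleft]
  rw [dirDeriv_eq_fderiv_extChartAt m hms (hu.mdifferentiableAt (by simp)),
    dirDeriv_eq_fderiv_extChartAt m hms ((hu.dirDeriv hY).mdifferentiableAt (by simp)),
    dirDeriv_eq_fderiv_extChartAt m hms ((hu.dirDeriv hX).mdifferentiableAt (by simp)),
    dirDeriv_extChartAt_mlieBracket, ← hφ, (inner X).fderiv_eq, (inner Y).fderiv_eq, XX, YY,
    fderiv_clm_apply hfd hdX, fderiv_clm_apply hfd hdY]
  -- Each iterated derivative contributes a second derivative of `û`, evaluated on `X'` and `Y'` in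
  -- opposite orders. Symmetry cancels these, and only the first derivative on the bracket remains.
  have hsym := (hûs.isSymmSndFDerivAt 
    (by simp only [minSmoothness_of_isRCLikeNormedField, ← one_add_one_eq_two]; norm_cast)).eq
    (X' (φ m)) (Y' (φ m))
  simp only [lieBracket, map_sub, add_apply, ContinuousLinearMap.comp_apply,
    ContinuousLinearMap.flip_apply]
  rw [hsym]
  abel

end Bracket

/-! ### Evaluation of tensors on vector fields along a map -/

section TensorsAlongMaps

variable {EN : Type*} [NormedAddCommGroup EN] [NormedSpace ℝ EN]
  {HN : Type*} [TopologicalSpace HN] {J : ModelWithCorners ℝ EN HN}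
  {N : Type*} [TopologicalSpace N] [ChartedSpace HN N] [IsManifold J ∞ N]
  {E : Type*} [NormedAddCommGroup E] [NormedSpace ℝ E] [FiniteDimensional ℝ E]
  {M : Type*} [TopologicalSpace M] [T2Space M] [ChartedSpace E M] [IsManifold 𝓘(ℝ, E) ∞ M]
  {V : Type*} [NormedAddCommGroup V] [NormedSpace ℝ V]

theorem ContMDiffAt.dirDeriv_along {φ : M → V} {f : N → M} {v : ∀ n, TangentSpace 𝓘(ℝ, E) (f n)}
    {n₀ : N} (hφ : ContMDiffAt 𝓘(ℝ, E) 𝓘(ℝ, V) ∞ φ (f n₀))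
    (hv : ContMDiffAt J 𝓘(ℝ, E).tangent ∞ (fun n => (⟨f n, v n⟩ : TangentBundle 𝓘(ℝ, E) M)) n₀) :
    ContMDiffAt J 𝓘(ℝ, V) ∞ (fun n => _root_.dirDeriv φ (f n) (v n)) n₀ :=
  ContMDiffAt.mfderiv_apply_vectorSpace (f := fun _ => φ) (g := f) (v := v)
    (hφ.comp (n₀, f n₀) contMDiffAt_snd) hv

/-- Vectors such as `TR_g(X p)`, with `g` and `p` both varying, form a field along a map rather than
a field on the target, so the smoothness hypothesis on `β` does not apply directly; the coordinate
expression of `β` does. -/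
theorem ContMDiffAt.linearForm_along (β : ∀ m : M, TangentSpace 𝓘(ℝ, E) m →ₗ[ℝ] V)
    (hβ : ∀ X : ∀ m : M, TangentSpace 𝓘(ℝ, E) m, IsSmoothVectorField X →
      ContMDiff 𝓘(ℝ, E) 𝓘(ℝ, V) ∞ fun m => β m (X m))
    {f : N → M} {v : ∀ n, TangentSpace 𝓘(ℝ, E) (f n)} {n₀ : N}
    (hv : ContMDiffAt J 𝓘(ℝ, E).tangent ∞ (fun n => (⟨f n, v n⟩ : TangentBundle 𝓘(ℝ, E) M)) n₀) :
    ContMDiffAt J 𝓘(ℝ, V) ∞ (fun n => β (f n) (v n)) n₀ := by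
  obtain ⟨b, hb, hev⟩ := exists_chart_linearForm β hβ (f n₀)
  have hf : ContMDiffAt J 𝓘(ℝ, E) ∞ f n₀ :=
    (Bundle.contMDiff_proj (TangentSpace 𝓘(ℝ, E))).contMDiffAt.comp n₀ hv
  refine ContMDiffAt.congr_of_eventuallyEq ?_
    ((hf.continuousAt.eventually hev).mono fun n hn => hn (v n))
  exact (hb.comp n₀ hf).clm_apply (ContMDiffAt.dirDeriv_along contMDiffAt_extChartAt hv)

theorem ContMDiffAt.bilinForm_along
    (h : ∀ m : M, TangentSpace 𝓘(ℝ, E) m →ₗ[ℝ] TangentSpace 𝓘(ℝ, E) m →ₗ[ℝ] ℝ)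
    (hh : ∀ X Y : ∀ m : M, TangentSpace 𝓘(ℝ, E) m, IsSmoothVectorField X →
      IsSmoothVectorField Y → ContMDiff 𝓘(ℝ, E) 𝓘(ℝ, ℝ) ∞ fun m => h m (X m) (Y m))
    {f : N → M} {v w : ∀ n, TangentSpace 𝓘(ℝ, E) (f n)} {n₀ : N}
    (hv : ContMDiffAt J 𝓘(ℝ, E).tangent ∞ (fun n => (⟨f n, v n⟩ : TangentBundle 𝓘(ℝ, E) M)) n₀)
    (hw : ContMDiffAt J 𝓘(ℝ, E).tangent ∞ (fun n => (⟨f n, w n⟩ : TangentBundle 𝓘(ℝ, E) M)) n₀) :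
    ContMDiffAt J 𝓘(ℝ, ℝ) ∞ (fun n => h (f n) (v n) (w n)) n₀ := by
  obtain ⟨b, hb, hev⟩ := exists_chart_bilinForm h hh (f n₀)
  have hf : ContMDiffAt J 𝓘(ℝ, E) ∞ f n₀ :=
    (Bundle.contMDiff_proj (TangentSpace 𝓘(ℝ, E))).contMDiffAt.comp n₀ hv
  refine ContMDiffAt.congr_of_eventuallyEq ?_
    ((hf.continuousAt.eventually hev).mono fun n hn => hn (v n) (w n))
  exact ((hb.comp n₀ hf).clm_apply (ContMDiffAt.dirDeriv_along contMDiffAt_extChartAt hv)).clm_apply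
    (ContMDiffAt.dirDeriv_along contMDiffAt_extChartAt hw)

end TensorsAlongMaps

/-! ### Fundamental vector fields and the vertical space -/

section PrincipalBundles

variable {E : Type*} [NormedAddCommGroup E] [NormedSpace ℝ E]
  {M : Type*} [TopologicalSpace M] [ChartedSpace E M] [IsManifold 𝓘(ℝ, E) ∞ M]
  {EG : Type*} [NormedAddCommGroup EG] [NormedSpace ℝ EG]
  {G : Type*} [TopologicalSpace G] [ChartedSpace EG G] [Group G] [LieGroup 𝓘(ℝ, EG) ∞ G]
  {EP : Type*} [NormedAddCommGroup EP] [NormedSpace ℝ EP]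
  {P : Type*} [TopologicalSpace P] [ChartedSpace EP P] [IsManifold 𝓘(ℝ, EP) ∞ P]
  [MulAction Gᵐᵒᵖ P] {π : P → M}

namespace IsSmoothPrincipalBundle

theorem contMDiff_smul_left (hP : IsSmoothPrincipalBundle E EG G EP π) (g : G) :
    ContMDiff 𝓘(ℝ, EP) 𝓘(ℝ, EP) ∞ (fun p : P => MulOpposite.op g • p) :=
  hP.smooth_action.comp (contMDiff_id.prodMk contMDiff_const)

theorem contMDiff_orbit (hP : IsSmoothPrincipalBundle E EG G EP π) (p : P) :
    ContMDiff 𝓘(ℝ, EG) 𝓘(ℝ, EP) ∞ (fun g : G => MulOpposite.op g • p) :=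
  hP.smooth_action.comp (contMDiff_const.prodMk contMDiff_id)

theorem isSmoothVectorField_fundamentalField (hP : IsSmoothPrincipalBundle E EG G EP π)
    (A : GroupLieAlgebra 𝓘(ℝ, EG) G) :
    IsSmoothVectorField (fundamentalField (EP := EP) (P := P) A) := by
  intro p
  have h := ContMDiffAt.mfderiv_apply_tangentBundle (J := 𝓘(ℝ, EP)) (I := 𝓘(ℝ, EG))
    (I' := 𝓘(ℝ, EP)) (f := fun (p : P) (g : G) => MulOpposite.op g • p) (g := fun _ => 1)
    (v := fun _ => A) (n₀ := p) hP.smooth_action.contMDiffAt contMDiffAt_const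
  refine h.congr_of_eventuallyEq (Eventually.of_forall fun q => ?_)
  exact TangentBundle.mk_congr (by simp) _

theorem rightTranslationDeriv_fundamentalField (hP : IsSmoothPrincipalBundle E EG G EP π) (g : G)
    (A : GroupLieAlgebra 𝓘(ℝ, EG) G) (p : P) :
    rightTranslationDeriv EP g p (fundamentalField A p) =
      fundamentalField (groupAd g⁻¹ A) (MulOpposite.op g • p) := by
  have hR := fun q : P => (hP.contMDiff_smul_left g).mdifferentiableAt (x := q) (by simp)
  have hO := fun (q : P) (h : G) => (hP.contMDiff_orbit q).mdifferentiableAt (x := h) (by simp)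
  have hA : MDifferentiableAt 𝓘(ℝ, EG) 𝓘(ℝ, EG) (fun h : G => g⁻¹ * h * g⁻¹⁻¹) 1 :=
    (((contMDiff_mul_right (I := 𝓘(ℝ, EG)) (n := ∞) (a := g⁻¹⁻¹)).comp
      (contMDiff_mul_left (I := 𝓘(ℝ, EG)) (n := ∞) (a := g⁻¹))).mdifferentiableAt (by simp))
  have h1 := mfderiv_comp_apply_of_eq (x := (1 : G)) (y := p) (hR p) (hO p 1) (by simp) A
  have h2 := mfderiv_comp_apply_of_eq (x := (1 : G)) (y := (1 : G))
    (hO (MulOpposite.op g • p) 1) hA (by simp) A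
  have hfun : (fun q : P => MulOpposite.op g • q) ∘ (fun h : G => MulOpposite.op h • p) =
      (fun h : G => MulOpposite.op h • (MulOpposite.op g • p)) ∘
        (fun h : G => g⁻¹ * h * g⁻¹⁻¹) := by
    funext h
    simp only [Function.comp_apply, smul_smul, ← MulOpposite.op_mul]
    congr 2
    group
  rw [hfun] at h1
  exact h1.symm.trans h2

theorem mfderiv_proj_fundamentalField (hP : IsSmoothPrincipalBundle E EG G EP π)
    (A : GroupLieAlgebra 𝓘(ℝ, EG) G) (p : P) :
    mfderiv 𝓘(ℝ, EP) 𝓘(ℝ, E) π p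
      (fundamentalField A p) = 0 := by
  have h1 := mfderiv_comp_apply_of_eq (x := (1 : G)) (y := p)
    (hP.smooth_proj.mdifferentiableAt (x := p) (by simp))
    ((hP.contMDiff_orbit p).mdifferentiableAt (x := 1) (by simp)) (by simp) A
  have hfun : π ∘ (fun g : G => MulOpposite.op g • p) = fun _ => π p := by
    funext g; simp [hP.proj_smul]
  rw [hfun, mfderiv_const] at h1
  exact h1.symm

end IsSmoothPrincipalBundle

theorem fundamentalField_add (A B : GroupLieAlgebra 𝓘(ℝ, EG) G) (p : P) :
    fundamentalField (EP := EP) (A + B) p = fundamentalField A p + fundamentalField B p :=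
  map_add (mfderiv 𝓘(ℝ, EG) 𝓘(ℝ, EP) (fun g : G => MulOpposite.op g • p) 1) A B

theorem fundamentalField_smul (c : ℝ) (A : GroupLieAlgebra 𝓘(ℝ, EG) G) (p : P) :
    fundamentalField (EP := EP) (c • A) p = c • fundamentalField A p :=
  map_smul (mfderiv 𝓘(ℝ, EG) 𝓘(ℝ, EP) (fun g : G => MulOpposite.op g • p) 1) c A

variable (EG G EP) in
/-- The infinitesimal action `A ↦ A_P(p)`, as a linear map. -/
def fundamentalMap (p : P) : EG →ₗ[ℝ] TangentSpace 𝓘(ℝ, EP) p where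
  toFun A := fundamentalField (EG := EG) (G := G) A p
  map_add' A B := fundamentalField_add (G := G) A B p
  map_smul' c A := fundamentalField_smul (G := G) c A p

theorem mfderiv_mul_left_leftInverse (g : G) (v : EG) :
    (mfderiv 𝓘(ℝ, EG) 𝓘(ℝ, EG) (fun h : G => g⁻¹ * h) g
      (mfderiv 𝓘(ℝ, EG) 𝓘(ℝ, EG) (fun h : G => g * h) 1 v : EG) : EG) = v := by
  have h := mfderiv_comp_apply_of_eq (x := (1 : G)) (y := g)
    ((contMDiff_mul_left (I := 𝓘(ℝ, EG)) (n := ∞) (a := g⁻¹)).mdifferentiableAt (by simp))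
    ((contMDiff_mul_left (I := 𝓘(ℝ, EG)) (n := ∞) (a := g)).mdifferentiableAt (by simp))
    (by simp) v
  have hfun : (fun h : G => g⁻¹ * h) ∘ (fun h : G => g * h) = id := by funext h; simp
  rw [hfun, mfderiv_id] at h
  exact h.symm

theorem mfderiv_mul_left_rightInverse (g : G) (v : EG) :
    (mfderiv 𝓘(ℝ, EG) 𝓘(ℝ, EG) (fun h : G => g * h) 1
      (mfderiv 𝓘(ℝ, EG) 𝓘(ℝ, EG) (fun h : G => g⁻¹ * h) g v : EG) : EG) = v := by
  have h := mfderiv_comp_apply_of_eq (x := g) (y := 1)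
    ((contMDiff_mul_left (I := 𝓘(ℝ, EG)) (n := ∞) (a := g)).mdifferentiableAt (by simp))
    ((contMDiff_mul_left (I := 𝓘(ℝ, EG)) (n := ∞) (a := g⁻¹)).mdifferentiableAt (by simp))
    (by simp) v
  have hfun : (fun h : G => g * h) ∘ (fun h : G => g⁻¹ * h) = id := by funext h; simp
  rw [hfun, mfderiv_id] at h
  exact h.symm

namespace IsSmoothPrincipalBundle

/-- `L` is the derivative at `p` of the `G`-component of a local trivialization and `g₀` is its
value at `p`. Equivariance makes that component `h ↦ g₀ * h` along the orbit; together with `π` it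
forms a local diffeomorphism, so the two derivatives have no common kernel. -/
theorem exists_fibreCoordinate (hP : IsSmoothPrincipalBundle E EG G EP π) (p : P) :
    ∃ (g₀ : G) (L : EP →L[ℝ] EG),
      (∀ A : EG, L (fundamentalMap EG G EP p A : EP) =
        (mfderiv 𝓘(ℝ, EG) 𝓘(ℝ, EG) (fun h : G => g₀ * h) 1 A : EG)) ∧
      ∀ v : EP, (mfderiv 𝓘(ℝ, EP) 𝓘(ℝ, E) π p v : E) = 0 → L v = 0 → v = 0 := by
  obtain ⟨e, hm, hs, hs', heq⟩ := hP.locally_trivial (π p)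
  have hp : p ∈ e.source := e.mem_source.2 hm
  have hep : MDifferentiableAt 𝓘(ℝ, EP) (𝓘(ℝ, E).prod 𝓘(ℝ, EG)) e p :=
    (hs.contMDiffAt (e.open_source.mem_nhds hp)).mdifferentiableAt (by simp)
  have hes : MDifferentiableAt (𝓘(ℝ, E).prod 𝓘(ℝ, EG)) 𝓘(ℝ, EP) e.toOpenPartialHomeomorph.symm
      (e p) :=
    (hs'.contMDiffAt (e.open_target.mem_nhds (e.map_source hp))).mdifferentiableAt (by simp)
  have hq : MDifferentiableAt 𝓘(ℝ, EP) 𝓘(ℝ, EG) (fun p' => (e p').2) p :=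
    mdifferentiableAt_snd.comp p hep
  refine ⟨(e p).2, mfderiv 𝓘(ℝ, EP) 𝓘(ℝ, EG) (fun p' => (e p').2) p, fun A => ?_, fun v h1 h2 => ?_⟩
  · have h := mfderiv_comp_apply_of_eq (x := (1 : G)) (y := p) hq
      ((hP.contMDiff_orbit p).mdifferentiableAt (x := 1) (by simp)) (by simp) A
    have hfun : (fun p' => (e p').2) ∘ (fun g : G => MulOpposite.op g • p) =
        fun g => (e p).2 * g := by
      funext g; exact heq p hp g
    rw [hfun] at h
    exact h.symm
  · have hid := mfderiv_comp_apply (x := p) hes hep v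
    have hfun : e.toOpenPartialHomeomorph.symm ∘ e =ᶠ[𝓝 p] id := by
      filter_upwards [e.open_source.mem_nhds hp] with x hx
      exact e.toOpenPartialHomeomorph.left_inv hx
    rw [hfun.mfderiv_eq, mfderiv_id] at hid
    have hpair : (mfderiv 𝓘(ℝ, EP) (𝓘(ℝ, E).prod 𝓘(ℝ, EG)) e p v : E × EG) = 0 := by
      have hπe : (fun x => (e x).1) =ᶠ[𝓝 p] π := by
        filter_upwards [e.open_source.mem_nhds hp] with x hx
        exact e.coe_fst hx
      have hprod := mfderiv_prodMk (mdifferentiableAt_fst.comp p hep) hq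
      have : mfderiv 𝓘(ℝ, EP) (𝓘(ℝ, E).prod 𝓘(ℝ, EG)) e p =
        mfderiv 𝓘(ℝ, EP) (𝓘(ℝ, E).prod 𝓘(ℝ, EG))
          (fun x => ((Prod.fst ∘ e) x, (e x).2)) p := rfl
      rw [this, hprod]
      have h3 : (mfderiv 𝓘(ℝ, EP) 𝓘(ℝ, E) (Prod.fst ∘ e) p v : E) = 0 := by
        rw [show Prod.fst ∘ e = fun x => (e x).1 from rfl, hπe.mfderiv_eq]
        exact h1
      exact Prod.ext h3 h2
    exact hid.trans ((congrArg (mfderiv (𝓘(ℝ, E).prod 𝓘(ℝ, EG)) 𝓘(ℝ, EP)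
      e.toOpenPartialHomeomorph.symm (e p)) hpair).trans (map_zero _))

theorem fundamentalField_injective (hP : IsSmoothPrincipalBundle E EG G EP π) (p : P)
    {A : GroupLieAlgebra 𝓘(ℝ, EG) G} (h : fundamentalField (EP := EP) A p = 0) : A = 0 := by
  obtain ⟨g₀, L, hL, -⟩ := hP.exists_fibreCoordinate p
  have h1 := hL A
  rw [show fundamentalMap EG G EP p A = (0 : EP) from h, map_zero] at h1
  exact (mfderiv_mul_left_leftInverse (EG := EG) (G := G) g₀ A).symm.trans
    ((congrArg (mfderiv 𝓘(ℝ, EG) 𝓘(ℝ, EG) (fun h : G => g₀⁻¹ * h) g₀) h1.symm).trans (map_zero _))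

theorem exists_fundamentalField_eq (hP : IsSmoothPrincipalBundle E EG G EP π) (p : P)
    {v : TangentSpace 𝓘(ℝ, EP) p} (hv : mfderiv 𝓘(ℝ, EP) 𝓘(ℝ, E) π p v = 0) :
    ∃ A : GroupLieAlgebra 𝓘(ℝ, EG) G, v = fundamentalField A p := by
  obtain ⟨g₀, L, hL, hinj⟩ := hP.exists_fibreCoordinate p
  -- The unique candidate: `L` sends the fundamental vector of `A` to the left translate of `A` by
  -- `g₀`, so `L v` is translated back to the identity. Then `v` minus that fundamental vector is
  -- killed by both `Tπ` and `L`.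
  let A : EG := mfderiv 𝓘(ℝ, EG) 𝓘(ℝ, EG) (fun h : G => g₀⁻¹ * h) g₀ (L v)
  refine ⟨A, sub_eq_zero.1 (hinj _ ?_ ?_)⟩
  · refine (map_sub (mfderiv 𝓘(ℝ, EP) 𝓘(ℝ, E) π p) v (fundamentalField A p)).trans ?_
    exact (congrArg₂ (fun a b : E => a - b) hv (hP.mfderiv_proj_fundamentalField A p)).trans
      (sub_zero _)
  · refine (map_sub L v (fundamentalMap EG G EP p A)).trans ?_
    exact (congrArg (fun a : EG => L v - a)
      ((hL A).trans (mfderiv_mul_left_rightInverse g₀ (L v)))).trans (sub_self _)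

end IsSmoothPrincipalBundle

/-- Fundamental vectors are vertical while `Tπ` is injective on `FP`, so the two meet only in zero.
This is what makes the Gram form on `𝔤` nondegenerate. -/
theorem IsFoliatedPrincipalBundle.eq_zero_of_fundamentalField_mem {F : SmoothFoliation E M}
    {FP : SmoothFoliation EP P} (hP : IsFoliatedPrincipalBundle EG G π FP F) {p : P}
    {A : GroupLieAlgebra 𝓘(ℝ, EG) G} (h : fundamentalField A p ∈ FP.tangent p) : A = 0 := by
  refine hP.principal.fundamentalField_injective p ((hP.bijOn p).injOn h (Submodule.zero_mem _) ?_)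
  rw [hP.principal.mfderiv_proj_fundamentalField, map_zero]

end PrincipalBundles

/-! ### Commutation of mixed partial derivatives on a product -/

section MixedPartials

variable {E : Type*} [NormedAddCommGroup E] [NormedSpace ℝ E]
  {M : Type*} [TopologicalSpace M] [ChartedSpace E M] [IsManifold 𝓘(ℝ, E) ∞ M]
  {E' : Type*} [NormedAddCommGroup E'] [NormedSpace ℝ E']
  {M' : Type*} [TopologicalSpace M'] [ChartedSpace E' M'] [IsManifold 𝓘(ℝ, E') ∞ M']
  {V : Type*} [NormedAddCommGroup V] [NormedSpace ℝ V]

theorem dirDeriv_eq_fderiv {u : M → V} {m : M} (hu : MDifferentiableAt 𝓘(ℝ, E) 𝓘(ℝ, V) u m)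
    (v : TangentSpace 𝓘(ℝ, E) m) :
    dirDeriv u m v =
      fderiv ℝ (u ∘ (extChartAt 𝓘(ℝ, E) m).symm) (extChartAt 𝓘(ℝ, E) m m) (v : E) := by
  simp only [dirDeriv, mfderiv, hu, modelWithCornersSelf_coe, Set.range_id,
    fderivWithin_univ]
  rfl

/-- Both sides are the second derivative of `F` at `(x, y)` on the vectors `(v, 0)` and `(0, w)`,
taken in opposite orders. -/
theorem fderiv_comm_of_contDiffAt {F : E × E' → V} {x : E} {y : E'} (hF : ContDiffAt ℝ ∞ F (x, y))
    (v : E) (w : E') :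
    fderiv ℝ (fun y' => fderiv ℝ (fun x' => F (x', y')) x v) y w =
      fderiv ℝ (fun x' => fderiv ℝ (fun y' => F (x', y')) y w) x v := by
  have hd : ∀ᶠ z in 𝓝 (x, y), DifferentiableAt ℝ F z := by
    filter_upwards [(hF.of_le (m := 1) (by simp)).eventually (by simp)] with z hz
    exact hz.differentiableAt (by simp)
  have h2 : DifferentiableAt ℝ (fderiv ℝ F) (x, y) :=
    (hF.fderiv_right (m := 1) (by norm_cast)).differentiableAt (by simp)
  have hl : (fun y' => fderiv ℝ (fun x' => F (x', y')) x v) =ᶠ[𝓝 y]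
      fun y' => fderiv ℝ F (x, y') (v, 0) := by
    have : ContinuousAt (fun y' : E' => (x, y')) y := by fun_prop
    filter_upwards [this.eventually hd] with y' hy'
    have hc := HasFDerivAt.comp x (f := fun x' : E => (x', y')) hy'.hasFDerivAt
      (hasFDerivAt_prodMk_left x y')
    exact congrArg (fun L => L v) hc.fderiv
  have hr : (fun x' => fderiv ℝ (fun y' => F (x', y')) y w) =ᶠ[𝓝 x]
      fun x' => fderiv ℝ F (x', y) (0, w) := by
    have : ContinuousAt (fun x' : E => (x', y)) x := by fun_prop
    filter_upwards [this.eventually hd] with x' hx'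
    have hc := HasFDerivAt.comp y (f := fun y' : E' => (x', y')) hx'.hasFDerivAt
      (hasFDerivAt_prodMk_right x' y)
    exact congrArg (fun L => L w) hc.fderiv
  rw [hl.fderiv_eq, hr.fderiv_eq]
  have el := (HasFDerivAt.comp y (f := fun y' : E' => (x, y')) h2.hasFDerivAt
    (hasFDerivAt_prodMk_right x y)).clm_apply (hasFDerivAt_const ((v, 0) : E × E') y)
  have er := (HasFDerivAt.comp x (f := fun x' : E => (x', y)) h2.hasFDerivAt
    (hasFDerivAt_prodMk_left x y)).clm_apply (hasFDerivAt_const ((0, w) : E × E') x)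
  have el' := congrArg (fun L => L w) el.fderiv
  have er' := congrArg (fun L => L v) er.fderiv
  refine el'.trans (Eq.trans ?_ er'.symm)
  have hsym := (hF.isSymmSndFDerivAt
    (by simp only [minSmoothness_of_isRCLikeNormedField, ← one_add_one_eq_two]; norm_cast)).eq
      ((v, 0) : E × E') (0, w)
  simpa using hsym.symm

/-- Mixed partial derivatives on a product of manifolds commute. -/
theorem dirDeriv_comm {F : M → M' → V} {m : M} {m' : M'}
    (hF : ContMDiffAt (𝓘(ℝ, E).prod 𝓘(ℝ, E')) 𝓘(ℝ, V) ∞ (Function.uncurry F) (m, m'))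
    (v : TangentSpace 𝓘(ℝ, E) m) (w : TangentSpace 𝓘(ℝ, E') m') :
    dirDeriv (fun y => dirDeriv (fun x => F x y) m v) m' w =
      dirDeriv (fun x => dirDeriv (F x) m' w) m v := by
  have hev : ∀ᶠ z in 𝓝 (m, m'), ContMDiffAt (𝓘(ℝ, E).prod 𝓘(ℝ, E')) 𝓘(ℝ, V) 1
      (Function.uncurry F) z :=
    (contMDiffAt_iff_contMDiffAt_nhds (by simp)).1 (hF.of_le (m := 1) (by simp))
  have hswap : ContMDiffAt (𝓘(ℝ, E').prod 𝓘(ℝ, E)) 𝓘(ℝ, V) ∞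
      (Function.uncurry fun y x => F x y) (m', m) :=
    hF.comp (m', m) (contMDiffAt_snd.prodMk contMDiffAt_fst)
  have h1 : ContMDiffAt 𝓘(ℝ, E') 𝓘(ℝ, V) ∞ (fun y => dirDeriv (fun x => F x y) m v) m' :=
    ContMDiffAt.mfderiv_apply_vectorSpace (f := fun y x => F x y) (g := fun _ => m)
      (v := fun _ => v) hswap contMDiffAt_const
  have h2 : ContMDiffAt 𝓘(ℝ, E) 𝓘(ℝ, V) ∞ (fun x => dirDeriv (F x) m' w) m :=
    ContMDiffAt.mfderiv_apply_vectorSpace (f := F) (g := fun _ => m')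
      (v := fun _ => w) hF contMDiffAt_const
  rw [dirDeriv_eq_fderiv (h1.mdifferentiableAt (by simp)),
    dirDeriv_eq_fderiv (h2.mdifferentiableAt (by simp))]
  set φ := extChartAt 𝓘(ℝ, E) m with hφ
  set ψ := extChartAt 𝓘(ℝ, E') m' with hψ
  have sφ : ContMDiffAt 𝓘(ℝ, E) 𝓘(ℝ, E) ∞ φ.symm (φ m) :=
    (contMDiffOn_extChartAt_symm (I := 𝓘(ℝ, E)) (n := ∞) m).contMDiffAt
      ((isOpen_extChartAt_target m).mem_nhds (mem_extChartAt_target m))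
  have sψ : ContMDiffAt 𝓘(ℝ, E') 𝓘(ℝ, E') ∞ ψ.symm (ψ m') :=
    (contMDiffOn_extChartAt_symm (I := 𝓘(ℝ, E')) (n := ∞) m').contMDiffAt
      ((isOpen_extChartAt_target m').mem_nhds (mem_extChartAt_target m'))
  have lφ : φ.symm (φ m) = m := extChartAt_to_inv m
  have lψ : ψ.symm (ψ m') = m' := extChartAt_to_inv m'
  have hF' : ContDiffAt ℝ ∞ (fun z : E × E' => F (φ.symm z.1) (ψ.symm z.2)) (φ m, ψ m') := by
    refine ContMDiffAt.contDiffAt ?_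
    refine ContMDiffAt.comp (I' := 𝓘(ℝ, E).prod 𝓘(ℝ, E')) (g := Function.uncurry F)
      (f := fun z : E × E' => (φ.symm z.1, ψ.symm z.2)) _ ?_ ?_
    · simpa only [lφ, lψ] using hF
    · exact (sφ.comp (φ m, ψ m') contDiff_fst.contMDiff.contMDiffAt).prodMk
        (sψ.comp (φ m, ψ m') contDiff_snd.contMDiff.contMDiffAt)
  have e1 : (fun y => dirDeriv (fun x => F x y) m v) ∘ ψ.symm =ᶠ[𝓝 (ψ m')]
      fun y => fderiv ℝ (fun x => F (φ.symm x) (ψ.symm y)) (φ m) v := by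
    have hc : ContinuousAt (fun y => (m, ψ.symm y)) (ψ m') :=
      continuousAt_const.prodMk sψ.continuousAt
    have hev' := hev
    rw [← lψ] at hev'
    filter_upwards [hc.eventually hev'] with y hy
    exact dirDeriv_eq_fderiv
      ((hy.comp m (contMDiffAt_id.prodMk contMDiffAt_const)).mdifferentiableAt
      (by simp)) v
  have e2 : (fun x => dirDeriv (F x) m' w) ∘ φ.symm =ᶠ[𝓝 (φ m)]
      fun x => fderiv ℝ (fun y => F (φ.symm x) (ψ.symm y)) (ψ m') w := by
    have hc : ContinuousAt (fun x => (φ.symm x, m')) (φ m) :=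
      sφ.continuousAt.prodMk continuousAt_const
    have hev' := hev
    rw [← lφ] at hev'
    filter_upwards [hc.eventually hev'] with x hx
    exact dirDeriv_eq_fderiv
      ((hx.comp m' (contMDiffAt_const.prodMk contMDiffAt_id)).mdifferentiableAt
      (by simp)) w
  rw [e1.fderiv_eq, e2.fderiv_eq]
  exact fderiv_comm_of_contDiffAt hF' v w

end MixedPartials

/-! ### Transverse metrics as degenerate forms on the tangent bundle -/

section NormalMetrics

variable {E : Type*} [NormedAddCommGroup E] [NormedSpace ℝ E]
  {M : Type*} [TopologicalSpace M] [ChartedSpace E M] [IsManifold 𝓘(ℝ, E) ∞ M]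
  {F : SmoothFoliation E M}

namespace SmoothFoliation

theorem toNormal_eq_zero {m : M} {v : TangentSpace 𝓘(ℝ, E) m} :
    F.toNormal m v = 0 ↔ v ∈ F.tangent m :=
  Submodule.Quotient.mk_eq_zero _

/-- A metric on the normal bundle, as a degenerate bilinear form on the tangent bundle. -/
def NormalMetric.lift (g : F.NormalMetric) (m : M) :
    TangentSpace 𝓘(ℝ, E) m →ₗ[ℝ] TangentSpace 𝓘(ℝ, E) m →ₗ[ℝ] ℝ :=
  (g.form m).compl₁₂ (F.toNormal m) (F.toNormal m)

theorem NormalMetric.lift_apply (g : F.NormalMetric) (m : M) (v w : TangentSpace 𝓘(ℝ, E) m) :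
    g.lift m v w = g.form m (F.toNormal m v) (F.toNormal m w) := rfl

theorem NormalMetric.lift_symm (g : F.NormalMetric) (m : M) (v w : TangentSpace 𝓘(ℝ, E) m) :
    g.lift m v w = g.lift m w v := g.symm m _ _

theorem NormalMetric.lift_eq_zero (g : F.NormalMetric) {m : M} {v : TangentSpace 𝓘(ℝ, E) m}
    (hv : v ∈ F.tangent m) (w : TangentSpace 𝓘(ℝ, E) m) : g.lift m v w = 0 := by
  rw [g.lift_apply, toNormal_eq_zero.2 hv, map_zero, LinearMap.zero_apply]

theorem NormalMetric.mem_tangent_of_lift_self_eq_zero (g : F.NormalMetric) {m : M}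
    {v : TangentSpace 𝓘(ℝ, E) m} (hv : g.lift m v v = 0) : v ∈ F.tangent m := by
  rw [← toNormal_eq_zero]
  by_contra h
  exact (g.pos m _ h).ne' hv

end SmoothFoliation

end NormalMetrics

/-! ### Brackets of tangent fields with fundamental fields -/

section PrincipalBundles

variable {E : Type*} [NormedAddCommGroup E] [NormedSpace ℝ E]
  {M : Type*} [TopologicalSpace M] [ChartedSpace E M] [IsManifold 𝓘(ℝ, E) ∞ M]
  {EG : Type*} [NormedAddCommGroup EG] [NormedSpace ℝ EG]
  {G : Type*} [TopologicalSpace G] [ChartedSpace EG G] [Group G] [LieGroup 𝓘(ℝ, EG) ∞ G]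
  {EP : Type*} [NormedAddCommGroup EP] [NormedSpace ℝ EP] [FiniteDimensional ℝ EP]
  {P : Type*} [TopologicalSpace P] [T2Space P] [ChartedSpace EP P] [IsManifold 𝓘(ℝ, EP) ∞ P]
  [MulAction Gᵐᵒᵖ P] {π : P → M}

/-- A one-form which vanishes on a vector field and on its right translates vanishes on the bracket
of this vector field with any fundamental vector field. -/
theorem IsSmoothPrincipalBundle.linearForm_mlieBracket_fundamentalField_eq_zero
    (hP : IsSmoothPrincipalBundle E EG G EP π) (β : ∀ p : P, TangentSpace 𝓘(ℝ, EP) p →ₗ[ℝ] ℝ)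
    (hβ : ∀ X : ∀ p : P, TangentSpace 𝓘(ℝ, EP) p, IsSmoothVectorField X →
      ContMDiff 𝓘(ℝ, EP) 𝓘(ℝ, ℝ) ∞ fun p => β p (X p))
    {Z : ∀ p : P, TangentSpace 𝓘(ℝ, EP) p} (hZ : IsSmoothVectorField Z)
    (hβZ : ∀ p, β p (Z p) = 0)
    (hβR : ∀ (g : G) (p : P), β (MulOpposite.op g • p) (rightTranslationDeriv EP g p (Z p)) = 0)
    (A : GroupLieAlgebra 𝓘(ℝ, EG) G) (p : P) :
    β p (mlieBracket 𝓘(ℝ, EP) Z (fundamentalField A) p) = 0 := by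
  obtain ⟨b, hb, hev⟩ := exists_chart_linearForm β hβ p
  set φ := extChartAt 𝓘(ℝ, EP) p with hφ
  have hA := hP.isSmoothVectorField_fundamentalField A
  have hφs : ContMDiffAt 𝓘(ℝ, EP) 𝓘(ℝ, EP) ∞ φ p := contMDiffAt_extChartAt
  have hone : MulOpposite.op (1 : G) • p = p := by simp
  have horb : MDifferentiableAt 𝓘(ℝ, EG) 𝓘(ℝ, EP) (fun g : G => MulOpposite.op g • p) 1 :=
    (hP.contMDiff_orbit p).mdifferentiableAt (by simp)
  have hFs : ContMDiffAt (𝓘(ℝ, EP).prod 𝓘(ℝ, EG)) 𝓘(ℝ, EP) ∞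
      (Function.uncurry fun (q : P) (g : G) => φ (MulOpposite.op g • q)) (p, 1) := by
    refine ContMDiffAt.comp (I' := 𝓘(ℝ, EP)) (p, (1 : G)) (g := φ) ?_
      hP.smooth_action.contMDiffAt
    simpa only [hone] using hφs
  have hFs' : ContMDiffAt (𝓘(ℝ, EG).prod 𝓘(ℝ, EP)) 𝓘(ℝ, EP) ∞
      (Function.uncurry fun (g : G) (q : P) => φ (MulOpposite.op g • q)) (1, p) :=
    ContMDiffAt.comp (f := fun x : G × P => (x.2, x.1)) (1, p) hFs
      (contMDiffAt_snd.prodMk contMDiffAt_fst)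
  have hD : ContMDiffAt 𝓘(ℝ, EG) 𝓘(ℝ, EP) ∞
      (fun g : G => dirDeriv (fun q => φ (MulOpposite.op g • q)) p (Z p)) 1 :=
    ContMDiffAt.mfderiv_apply_vectorSpace (f := fun (g : G) (q : P) => φ (MulOpposite.op g • q))
      (g := fun _ => p) (v := fun _ => Z p) hFs' contMDiffAt_const
  have hbd : MDifferentiableAt 𝓘(ℝ, EP) 𝓘(ℝ, EP →L[ℝ] ℝ) b p := hb.mdifferentiableAt (by simp)
  have hbo : MDifferentiableAt 𝓘(ℝ, EG) 𝓘(ℝ, EP →L[ℝ] ℝ)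
      (fun g : G => b (MulOpposite.op g • p)) 1 :=
    MDifferentiableAt.comp (I' := 𝓘(ℝ, EP)) (g := b) 1 (by rwa [hone]) horb
  have hsrc : ∀ᶠ q in 𝓝 p, q ∈ (chartAt EP p).source :=
    (chartAt EP p).open_source.eventually_mem (mem_chart_source EP p)
  have htend : Tendsto (fun g : G => MulOpposite.op g • p) (𝓝 1) (𝓝 p) := by
    have := horb.continuousAt
    rwa [ContinuousAt, hone] at this
  have orbitDeriv : ∀ {W : Type _} [NormedAddCommGroup W] [NormedSpace ℝ W] (u : P → W) (q : P),
      MDifferentiableAt 𝓘(ℝ, EP) 𝓘(ℝ, W) u q →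
      dirDeriv (E := EG) (fun g : G => u (MulOpposite.op g • q)) 1 A =
        dirDeriv (E := EP) u q (fundamentalField A q) := by
    intro W _ _ u q hu
    exact mfderiv_comp_apply_of_eq (x := (1 : G)) (y := q) hu
      ((hP.contMDiff_orbit q).mdifferentiableAt (by simp)) (by simp) A
  -- In coordinates, `g ↦ β(TR_g(Z p))` vanishes near the identity of `G`; its derivative there
  -- along `A` is one of two relations to be compared.
  have e1 : dirDeriv (E := EG) (fun g : G => b (MulOpposite.op g • p)
      (dirDeriv (fun q => φ (MulOpposite.op g • q)) p (Z p))) 1 A = 0 := by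
    refine dirDeriv_eq_zero ?_ _
    filter_upwards [htend.eventually hev, htend.eventually hsrc] with g hg hs
    rw [← hβR g p, hg, rightTranslationDeriv]
    congr 1
    exact dirDeriv_comp (mdifferentiableAt_extChartAt hs)
      ((hP.contMDiff_smul_left g).mdifferentiableAt (by simp)) (Z p)
  -- The second relation: `β(Z)` vanishes near `p`, so its derivative along the fundamental field
  -- does too.
  have e2 : dirDeriv (E := EP) (fun q => b q (dirDeriv φ q (Z q))) p
      (fundamentalField A p) = 0 := by
    refine dirDeriv_eq_zero ?_ _
    filter_upwards [hev] with q hq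
    rw [← hβZ q, hq]
  -- Exchanging the derivatives in `G` and in `P` turns the second term of the first relation into
  -- `b(Z(A_P φ))`. In the other relation it is `b(A_P(Z φ))`, while the terms differentiating `b`
  -- agree; the difference is `b([Z, A_P] φ)`.
  rw [dirDeriv_clm_apply hbo (hD.mdifferentiableAt (by simp)), dirDeriv_comm hFs,
    orbitDeriv b p hbd] at e1
  rw [dirDeriv_clm_apply hbd ((hφs.dirDeriv hZ).mdifferentiableAt (by simp))] at e2
  have e3 : dirDeriv (fun q => dirDeriv (E := EG) (fun g : G => φ (MulOpposite.op g • q)) 1 A) p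
      (Z p) =
      dirDeriv (fun q => dirDeriv (E := EP) φ q (fundamentalField A q)) p (Z p) := by
    refine Filter.EventuallyEq.dirDeriv_eq ?_ _
    filter_upwards [hsrc] with q hq
    exact orbitDeriv φ q (mdifferentiableAt_extChartAt hq)
  have hfun : (fun q => φ (MulOpposite.op (1 : G) • q)) = φ := by funext q; simp
  rw [e3, hfun, hone] at e1
  rw [hev.self_of_nhds, dirDeriv_mlieBracket hφs hZ hA, map_sub]
  linarith

variable [FiniteDimensional ℝ EG] {F : SmoothFoliation E M} {FP : SmoothFoliation EP P}

/-- The previous result is applied to the one-form `g(·, Y)`, where `Y` extends the value of the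
bracket at `p`. This form kills `FP`, hence `Z` and its translates, so the bracket has zero length
and lies in `FP`. Here the metric only serves to detect `FP`, and its invariance plays no role. -/
theorem IsFoliatedPrincipalBundle.mlieBracket_fundamentalField_mem
    (hP : IsFoliatedPrincipalBundle EG G π FP F) (g : FP.NormalMetric)
    {Z : ∀ p : P, TangentSpace 𝓘(ℝ, EP) p} (hZ : FP.IsTangentField Z)
    (A : GroupLieAlgebra 𝓘(ℝ, EG) G) (p : P) :
    mlieBracket 𝓘(ℝ, EP) Z (fundamentalField A) p ∈ FP.tangent p := by
  obtain ⟨Y, hY, hYp⟩ := exists_isSmoothVectorField_eq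
    (mlieBracket 𝓘(ℝ, EP) Z (fundamentalField A) p)
  refine g.mem_tangent_of_lift_self_eq_zero ?_
  have := hP.principal.linearForm_mlieBracket_fundamentalField_eq_zero
    (fun q => (g.lift q).flip (Y q)) (fun X hX => g.smooth X Y hX hY) hZ.1
    (fun q => g.lift_eq_zero (hZ.2 q) _) (fun a q => g.lift_eq_zero ?_ _) A p
  · rw [← hYp] at this ⊢
    exact this
  · rw [← hP.invariant a q]
    exact Submodule.mem_map_of_mem (hZ.2 q)

end PrincipalBundles

/-! ### Invariance of a pulled back transverse metric -/

section PullbackMetric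

variable {E : Type*} [NormedAddCommGroup E] [NormedSpace ℝ E] [FiniteDimensional ℝ E]
  {M : Type*} [TopologicalSpace M] [T2Space M] [ChartedSpace E M] [IsManifold 𝓘(ℝ, E) ∞ M]
  {E' : Type*} [NormedAddCommGroup E'] [NormedSpace ℝ E']
  {N : Type*} [TopologicalSpace N] [ChartedSpace E' N] [IsManifold 𝓘(ℝ, E') ∞ N]

/-- The Lie derivative of a pulled back bilinear form, in terms of its coordinate expression. -/
theorem lieDeriv_pullback_bilinForm
    {h : ∀ m : M, TangentSpace 𝓘(ℝ, E) m →ₗ[ℝ] TangentSpace 𝓘(ℝ, E) m →ₗ[ℝ] ℝ}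
    {H : M → E →L[ℝ] E →L[ℝ] ℝ} {f : N → M} {n₀ : N} {φ : M → E}
    (hH : ContMDiffAt 𝓘(ℝ, E) 𝓘(ℝ, E →L[ℝ] E →L[ℝ] ℝ) ∞ H (f n₀))
    (hφ : ContMDiffAt 𝓘(ℝ, E) 𝓘(ℝ, E) ∞ φ (f n₀))
    (hev : ∀ᶠ m in 𝓝 (f n₀), ∀ v w, h m v w = H m (dirDeriv φ m v) (dirDeriv φ m w))
    (hf : ContMDiff 𝓘(ℝ, E') 𝓘(ℝ, E) ∞ f) {W X Y : ∀ n : N, TangentSpace 𝓘(ℝ, E') n}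
    (hW : IsSmoothVectorField W) (hX : IsSmoothVectorField X) (hY : IsSmoothVectorField Y) :
    dirDeriv (fun n => h (f n) (mfderiv 𝓘(ℝ, E') 𝓘(ℝ, E) f n (X n))
        (mfderiv 𝓘(ℝ, E') 𝓘(ℝ, E) f n (Y n))) n₀ (W n₀) =
      h (f n₀) (mfderiv 𝓘(ℝ, E') 𝓘(ℝ, E) f n₀ (mlieBracket 𝓘(ℝ, E') W X n₀))
        (mfderiv 𝓘(ℝ, E') 𝓘(ℝ, E) f n₀ (Y n₀)) +
      h (f n₀) (mfderiv 𝓘(ℝ, E') 𝓘(ℝ, E) f n₀ (X n₀))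
        (mfderiv 𝓘(ℝ, E') 𝓘(ℝ, E) f n₀ (mlieBracket 𝓘(ℝ, E') W Y n₀)) +
      (dirDeriv (fun n => H (f n)) n₀ (W n₀) (dirDeriv (fun n => φ (f n)) n₀ (X n₀))
          (dirDeriv (fun n => φ (f n)) n₀ (Y n₀)) +
        H (f n₀) (dirDeriv (fun n => dirDeriv (fun n => φ (f n)) n (W n)) n₀ (X n₀))
          (dirDeriv (fun n => φ (f n)) n₀ (Y n₀)) +
        H (f n₀) (dirDeriv (fun n => φ (f n)) n₀ (X n₀))
          (dirDeriv (fun n => dirDeriv (fun n => φ (f n)) n (W n)) n₀ (Y n₀))) := by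
  have hfd : ∀ n, MDifferentiableAt 𝓘(ℝ, E') 𝓘(ℝ, E) f n := fun n =>
    hf.mdifferentiableAt (by simp)
  have hu : ContMDiffAt 𝓘(ℝ, E') 𝓘(ℝ, E) ∞ (fun n => φ (f n)) n₀ := hφ.comp n₀ hf.contMDiffAt
  have hHf : ContMDiffAt 𝓘(ℝ, E') 𝓘(ℝ, E →L[ℝ] E →L[ℝ] ℝ) ∞ (fun n => H (f n)) n₀ :=
    hH.comp n₀ hf.contMDiffAt
  have hφd : ∀ᶠ m in 𝓝 (f n₀), MDifferentiableAt 𝓘(ℝ, E) 𝓘(ℝ, E) φ m := by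
    filter_upwards [(contMDiffAt_iff_contMDiffAt_nhds (by simp)).1 (hφ.of_le (m := 1) (by simp))]
      with m hm
    exact hm.mdifferentiableAt (by simp)
  have hev' : ∀ᶠ n in 𝓝 n₀, ∀ v w, h (f n) (mfderiv 𝓘(ℝ, E') 𝓘(ℝ, E) f n v)
      (mfderiv 𝓘(ℝ, E') 𝓘(ℝ, E) f n w) =
      H (f n) (dirDeriv (fun n => φ (f n)) n v) (dirDeriv (fun n => φ (f n)) n w) := by
    filter_upwards [hf.continuous.continuousAt.eventually hev,
      hf.continuous.continuousAt.eventually hφd] with n h1 h2 v w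
    rw [h1, dirDeriv_comp h2 (hfd n), dirDeriv_comp h2 (hfd n)]
  have hXu := (hu.dirDeriv hX).mdifferentiableAt (show (∞ : WithTop ℕ∞) ≠ 0 by simp)
  have hYu := (hu.dirDeriv hY).mdifferentiableAt (show (∞ : WithTop ℕ∞) ≠ 0 by simp)
  have hHd := hHf.mdifferentiableAt (show (∞ : WithTop ℕ∞) ≠ 0 by simp)
  have hHX : MDifferentiableAt 𝓘(ℝ, E') 𝓘(ℝ, E →L[ℝ] ℝ)
      (fun n => H (f n) (dirDeriv (fun n => φ (f n)) n (X n))) n₀ :=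
    (hHf.clm_apply (hu.dirDeriv hX)).mdifferentiableAt (by simp)
  rw [Filter.EventuallyEq.dirDeriv_eq (hev'.mono fun n hn => hn (X n) (Y n)),
    dirDeriv_clm_apply hHX hYu, dirDeriv_clm_apply hHd hXu, hev'.self_of_nhds, hev'.self_of_nhds,
    dirDeriv_mlieBracket hu hW hX, dirDeriv_mlieBracket hu hW hY]
  simp only [add_apply, map_sub, sub_apply]
  ring

variable [FiniteDimensional ℝ E'] [T2Space N] {F : SmoothFoliation E M}

/-- The pullback of an invariant transverse metric is invariant under the vector fields whose
image is tangent to the foliation. -/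
theorem SmoothFoliation.NormalMetric.IsInvariant.lieDeriv_pullback {g : F.NormalMetric}
    (hg : g.IsInvariant) {f : N → M} (hf : ContMDiff 𝓘(ℝ, E') 𝓘(ℝ, E) ∞ f)
    {W X Y : ∀ n : N, TangentSpace 𝓘(ℝ, E') n} (hW : IsSmoothVectorField W)
    (hWF : ∀ n, mfderiv 𝓘(ℝ, E') 𝓘(ℝ, E) f n (W n) ∈ F.tangent (f n))
    (hX : IsSmoothVectorField X) (hY : IsSmoothVectorField Y) (n₀ : N) :
    dirDeriv (fun n => g.lift (f n) (mfderiv 𝓘(ℝ, E') 𝓘(ℝ, E) f n (X n))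
        (mfderiv 𝓘(ℝ, E') 𝓘(ℝ, E) f n (Y n))) n₀ (W n₀) =
      g.lift (f n₀) (mfderiv 𝓘(ℝ, E') 𝓘(ℝ, E) f n₀ (mlieBracket 𝓘(ℝ, E') W X n₀))
        (mfderiv 𝓘(ℝ, E') 𝓘(ℝ, E) f n₀ (Y n₀)) +
      g.lift (f n₀) (mfderiv 𝓘(ℝ, E') 𝓘(ℝ, E) f n₀ (X n₀))
        (mfderiv 𝓘(ℝ, E') 𝓘(ℝ, E) f n₀ (mlieBracket 𝓘(ℝ, E') W Y n₀)) := by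
  obtain ⟨H, hH, hev⟩ := exists_chart_bilinForm g.lift (fun X Y hX hY => g.smooth X Y hX hY) (f n₀)
  set φ := extChartAt 𝓘(ℝ, E) (f n₀) with hφdef
  have hφ : ContMDiffAt 𝓘(ℝ, E) 𝓘(ℝ, E) ∞ φ (f n₀) := contMDiffAt_extChartAt
  -- `W` need not be related by `f` to any field on `M`. A tangent field `Z` agreeing with the image
  -- of `W` at the single point `f n₀` is enough.
  obtain ⟨Z, hZ, hZm⟩ := F.exists_isTangentField_eq (hWF n₀)
  obtain ⟨ξ, hξ, hξm⟩ := exists_isSmoothVectorField_eq (mfderiv 𝓘(ℝ, E') 𝓘(ℝ, E) f n₀ (X n₀))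
  obtain ⟨η, hη, hηm⟩ := exists_isSmoothVectorField_eq (mfderiv 𝓘(ℝ, E') 𝓘(ℝ, E) f n₀ (Y n₀))
  have hsrc : ∀ᶠ m in 𝓝 (f n₀), m ∈ (chartAt E (f n₀)).source :=
    (chartAt E (f n₀)).open_source.eventually_mem (mem_chart_source E (f n₀))
  have hfd : ∀ n, MDifferentiableAt 𝓘(ℝ, E') 𝓘(ℝ, E) f n := fun n =>
    hf.mdifferentiableAt (by simp)
  have hHF : ∀ᶠ m in 𝓝 (f n₀), ∀ v ∈ F.tangent m, H m (dirDeriv φ m v) = 0 := by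
    filter_upwards [hev, hsrc] with m hm hs v hv
    ext c
    have := hm v (chartField (f n₀) c m)
    rw [g.lift_eq_zero hv, dirDeriv_extChartAt_chartField hs] at this
    exact this.symm
  have hsymm : ∀ a b, H (f n₀) a b = H (f n₀) b a := by
    intro a b
    have h1 := hev.self_of_nhds (chartField (f n₀) a (f n₀)) (chartField (f n₀) b (f n₀))
    have h2 := hev.self_of_nhds (chartField (f n₀) b (f n₀)) (chartField (f n₀) a (f n₀))
    rw [dirDeriv_extChartAt_chartField hsrc.self_of_nhds,
      dirDeriv_extChartAt_chartField hsrc.self_of_nhds] at h1 h2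
    rw [← h1, ← h2, g.lift_symm]
  have hu : ContMDiffAt 𝓘(ℝ, E') 𝓘(ℝ, E) ∞ (fun n => φ (f n)) n₀ := hφ.comp n₀ hf.contMDiffAt
  have hZφ : ContMDiffAt 𝓘(ℝ, E) 𝓘(ℝ, E) ∞ (fun m => dirDeriv φ m (Z m)) (f n₀) :=
    hφ.dirDeriv hZ.1
  have hZφf : ContMDiffAt 𝓘(ℝ, E') 𝓘(ℝ, E) ∞ (fun n => dirDeriv φ (f n) (Z (f n))) n₀ :=
    hZφ.comp n₀ hf.contMDiffAt
  have hWu := hu.dirDeriv hW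
  have hφd : MDifferentiableAt 𝓘(ℝ, E) 𝓘(ℝ, E) φ (f n₀) := hφ.mdifferentiableAt (by simp)
  have hHd : MDifferentiableAt 𝓘(ℝ, E) 𝓘(ℝ, E →L[ℝ] E →L[ℝ] ℝ) H (f n₀) :=
    hH.mdifferentiableAt (by simp)
  have hHfd : MDifferentiableAt 𝓘(ℝ, E') 𝓘(ℝ, E →L[ℝ] E →L[ℝ] ℝ) (fun n => H (f n)) n₀ :=
    (hH.comp n₀ hf.contMDiffAt).mdifferentiableAt (by simp)
  -- The coordinate fields of `W` and of `Z` along `f` differ by a function which lies in the image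
  -- of `F`, hence is killed by `H`, and which vanishes at `n₀`. Differentiating `H(difference) = 0`
  -- at `n₀` removes the derivative of `H` and leaves `H` applied to the derivative of the
  -- difference.
  have key : ∀ x : TangentSpace 𝓘(ℝ, E') n₀,
      H (f n₀) (dirDeriv (fun n => dirDeriv (fun n => φ (f n)) n (W n)) n₀ x) =
      H (f n₀) (dirDeriv (fun m => dirDeriv φ m (Z m)) (f n₀)
        (mfderiv 𝓘(ℝ, E') 𝓘(ℝ, E) f n₀ x)) := by
    intro x
    have hz : dirDeriv (fun n => H (f n) (dirDeriv (fun n => φ (f n)) n (W n) -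
        dirDeriv φ (f n) (Z (f n)))) n₀ x = 0 := by
      refine dirDeriv_eq_zero ?_ _
      filter_upwards [hf.continuous.continuousAt.eventually hHF,
        hf.continuous.continuousAt.eventually hsrc] with n h1 h2
      rw [map_sub, dirDeriv_comp (mdifferentiableAt_extChartAt h2) (hfd n), h1 _ (hWF n),
        h1 _ (hZ.2 _), sub_zero]
    have h0 : dirDeriv (fun n => φ (f n)) n₀ (W n₀) - dirDeriv φ (f n₀) (Z (f n₀)) = 0 := by
      rw [hZm, dirDeriv_comp hφd (hfd n₀), sub_self]
    rw [dirDeriv_clm_apply hHfd ((hWu.sub hZφf).mdifferentiableAt (by simp)), h0, map_zero,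
      zero_add, dirDeriv_sub (hWu.mdifferentiableAt (by simp)) (hZφf.mdifferentiableAt (by simp)),
      map_sub, sub_eq_zero] at hz
    rw [hz, dirDeriv_comp (hZφ.mdifferentiableAt (by simp)) (hfd n₀)]
  -- The same formula is used for the identity of `M` with `Z` and for `f` with `W`. Invariance of
  -- `g` makes the correction term vanish in the first case, and `key` identifies it with the
  -- correction term in the second.
  have hM := lieDeriv_pullback_bilinForm (f := id) (n₀ := f n₀) hH hφ hev contMDiff_id hZ.1 hξ hη
  have hN := lieDeriv_pullback_bilinForm (f := f) (n₀ := n₀) hH hφ hev hf hW hX hY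
  have hinv := hg Z ξ η hZ hξ hη (f n₀)
  simp only [mfderiv_id, id_eq] at hM
  rw [hN, add_eq_left]
  have hM' := hM.symm.trans hinv
  rw [hξm, hηm, hZm] at hM'
  have hM2 := add_eq_left.1 hM'
  rw [dirDeriv_comp hφd (hfd n₀), dirDeriv_comp hφd (hfd n₀), dirDeriv_comp hHd (hfd n₀), key,
    hsymm _ (dirDeriv (fun n => dirDeriv (fun n => φ (f n)) n (W n)) n₀ (Y n₀)), key, 
    hsymm (dirDeriv (fun m => dirDeriv φ m (Z m)) (f n₀) (mfderiv 𝓘(ℝ, E') 𝓘(ℝ, E) f n₀ (Y n₀)))]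
  exact hM2

end PullbackMetric

/-! ### From a basic connection to a transverse metric -/

section MetricOfConnection

variable {E : Type*} [NormedAddCommGroup E] [NormedSpace ℝ E] [FiniteDimensional ℝ E]
  {M : Type*} [TopologicalSpace M] [T2Space M] [ChartedSpace E M] [IsManifold 𝓘(ℝ, E) ∞ M]
  {EG : Type*} [NormedAddCommGroup EG] [NormedSpace ℝ EG] [FiniteDimensional ℝ EG]
  {G : Type*} [TopologicalSpace G] [ChartedSpace EG G] [Group G] [LieGroup 𝓘(ℝ, EG) ∞ G]
  {EP : Type*} [NormedAddCommGroup EP] [NormedSpace ℝ EP] [FiniteDimensional ℝ EP]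
  {P : Type*} [TopologicalSpace P] [T2Space P] [ChartedSpace EP P] [IsManifold 𝓘(ℝ, EP) ∞ P]
  [MulAction Gᵐᵒᵖ P] {π : P → M} {F : SmoothFoliation E M} {FP : SmoothFoliation EP P}

variable (EG) in
/-- An auxiliary inner product on a finite-dimensional real normed space. -/
def auxInner : EG →L[ℝ] EG →L[ℝ] ℝ :=
  (innerSL ℝ (E := EuclideanSpace ℝ (Fin (Module.finrank ℝ EG)))).bilinearComp
    (toEuclidean (E := EG) : EG →L[ℝ] _) (toEuclidean (E := EG) : EG →L[ℝ] _)

theorem auxInner_apply (a b : EG) : auxInner EG a b = inner ℝ (toEuclidean a) (toEuclidean b) := rfl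

theorem auxInner_symm (a b : EG) : auxInner EG a b = auxInner EG b a := by
  rw [auxInner_apply, auxInner_apply, real_inner_comm]

theorem auxInner_self_nonneg (a : EG) : 0 ≤ auxInner EG a a := by
  rw [auxInner_apply]; exact real_inner_self_nonneg

theorem eq_zero_of_auxInner_self_eq_zero {a : EG} (h : auxInner EG a a = 0) : a = 0 := by
  rw [auxInner_apply, inner_self_eq_zero] at h
  simpa using h

namespace PrincipalConnection

/-- The connection form, with values in the underlying vector space of the Lie algebra. -/
def formMap (θ : PrincipalConnection EG G EP P) (p : P) : TangentSpace 𝓘(ℝ, EP) p →ₗ[ℝ] EG :=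
  θ.form p

theorem contMDiff_eval (θ : PrincipalConnection EG G EP P)
    {X : ∀ p : P, TangentSpace 𝓘(ℝ, EP) p} (hX : IsSmoothVectorField X) :
    ContMDiff 𝓘(ℝ, EP) 𝓘(ℝ, EG) ∞ (θ.eval X) := θ.smooth X hX

/-- As `θ(Z) = 0` identically, the middle term of `dθ(Z, Y)` drops out, and `i(Z)dθ = 0` becomes
`L_Z θ = 0`. -/
theorem IsBasic.dirDeriv_eval {θ : PrincipalConnection EG G EP P} (hθ : θ.IsBasic FP)
    {Z Y : ∀ p : P, TangentSpace 𝓘(ℝ, EP) p} (hZ : FP.IsTangentField Z)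
    (hY : IsSmoothVectorField Y) (p : P) :
    dirDeriv (θ.eval Y) p (Z p) = θ.eval (mlieBracket 𝓘(ℝ, EP) Z Y) p := by
  have h := (hθ Z hZ).2 Y hY p
  rw [extDeriv, dirDeriv_eq_zero (Eventually.of_forall (hθ Z hZ).1), sub_zero, sub_eq_zero] at h
  exact h

theorem IsBasic.form_eq_zero {θ : PrincipalConnection EG G EP P} (hθ : θ.IsBasic FP) {p : P}
    {v : TangentSpace 𝓘(ℝ, EP) p} (hv : v ∈ FP.tangent p) : θ.form p v = 0 := by
  obtain ⟨Z, hZ, rfl⟩ := FP.exists_isTangentField_eq hv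
  exact (hθ Z hZ).1 p

end PrincipalConnection

theorem IsFoliatedPrincipalBundle.mfderiv_mem (hP : IsFoliatedPrincipalBundle EG G π FP F) {p : P}
    {v : TangentSpace 𝓘(ℝ, EP) p} (hv : v ∈ FP.tangent p) :
    mfderiv 𝓘(ℝ, EP) 𝓘(ℝ, E) π p v ∈ F.tangent (π p) := (hP.bijOn p).mapsTo hv

variable (π) in
/-- The degenerate metric `π^* g + ⟨θ, θ⟩` on the total space. -/
def connectionBilin (g : F.NormalMetric) (θ : PrincipalConnection EG G EP P) (p : P) :
    TangentSpace 𝓘(ℝ, EP) p →ₗ[ℝ] TangentSpace 𝓘(ℝ, EP) p →ₗ[ℝ] ℝ :=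
  (g.lift (π p)).compl₁₂ (mfderiv 𝓘(ℝ, EP) 𝓘(ℝ, E) π p).toLinearMap
      (mfderiv 𝓘(ℝ, EP) 𝓘(ℝ, E) π p).toLinearMap +
    ((ContinuousLinearMap.coeLM ℝ) ∘ₗ (auxInner EG).toLinearMap).compl₁₂ (θ.formMap p) (θ.formMap p)

theorem connectionBilin_apply (g : F.NormalMetric) (θ : PrincipalConnection EG G EP P) (p : P)
    (v w : TangentSpace 𝓘(ℝ, EP) p) : connectionBilin π g θ p v w =
      g.lift (π p) (mfderiv 𝓘(ℝ, EP) 𝓘(ℝ, E) π p v) (mfderiv 𝓘(ℝ, EP) 𝓘(ℝ, E) π p w) +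
      auxInner EG (θ.form p v) (θ.form p w) := rfl

theorem connectionBilin_symm (g : F.NormalMetric) (θ : PrincipalConnection EG G EP P) (p : P)
    (v w : TangentSpace 𝓘(ℝ, EP) p) :
    connectionBilin π g θ p v w = connectionBilin π g θ p w v := by
  rw [connectionBilin_apply, connectionBilin_apply, g.lift_symm]
  exact congrArg _ (auxInner_symm _ _)

theorem connectionBilin_eq_zero (hP : IsFoliatedPrincipalBundle EG G π FP F) (g : F.NormalMetric)
    {θ : PrincipalConnection EG G EP P} (hθ : θ.IsBasic FP) {p : P} {v : TangentSpace 𝓘(ℝ, EP) p}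
    (hv : v ∈ FP.tangent p) (w : TangentSpace 𝓘(ℝ, EP) p) : connectionBilin π g θ p v w = 0 := by
  rw [connectionBilin_apply, g.lift_eq_zero (hP.mfderiv_mem hv), zero_add, hθ.form_eq_zero hv]
  exact congrArg (fun L : EG →L[ℝ] ℝ => L (θ.form p w)) (map_zero (auxInner EG))

theorem connectionBilin_self_nonneg (g : F.NormalMetric) (θ : PrincipalConnection EG G EP P) (p : P)
    (v : TangentSpace 𝓘(ℝ, EP) p) : 0 ≤ connectionBilin π g θ p v v := by
  rw [connectionBilin_apply]
  refine add_nonneg ?_ (auxInner_self_nonneg (EG := EG) _)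
  by_cases h : F.toNormal (π p) (mfderiv 𝓘(ℝ, EP) 𝓘(ℝ, E) π p v) = 0
  · rw [g.lift_apply, h, map_zero]
  · exact (g.pos _ _ h).le

/-- Both summands of the square vanish. So `Tπ v` lies in `F` and lifts to some `w` in `FP`; then `v
- w` is vertical and annihilated by `θ`, hence zero. -/
theorem mem_tangent_of_connectionBilin_self_eq_zero (hP : IsFoliatedPrincipalBundle EG G π FP F)
    (g : F.NormalMetric) {θ : PrincipalConnection EG G EP P} (hθ : θ.IsBasic FP) {p : P}
    {v : TangentSpace 𝓘(ℝ, EP) p} (hv : connectionBilin π g θ p v v = 0) : v ∈ FP.tangent p := by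
  rw [connectionBilin_apply] at hv
  have h1 : 0 ≤ g.lift (π p) (mfderiv 𝓘(ℝ, EP) 𝓘(ℝ, E) π p v)
      (mfderiv 𝓘(ℝ, EP) 𝓘(ℝ, E) π p v) := by
    by_cases h : F.toNormal (π p) (mfderiv 𝓘(ℝ, EP) 𝓘(ℝ, E) π p v) = 0
    · rw [g.lift_apply, h, map_zero]
    · exact (g.pos _ _ h).le
  have h2 := auxInner_self_nonneg (EG := EG) (θ.form p v)
  have hv1 := g.mem_tangent_of_lift_self_eq_zero (le_antisymm (by linarith) h1)
  have hv2 : θ.form p v = 0 :=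
    eq_zero_of_auxInner_self_eq_zero (EG := EG) (le_antisymm (by linarith) h2)
  obtain ⟨w, hw, hwv⟩ := (hP.bijOn p).surjOn hv1
  obtain ⟨A, hA⟩ := hP.principal.exists_fundamentalField_eq p (v := v - w)
    (by rw [map_sub, hwv, sub_self])
  have hA0 : A = 0 := by
    rw [← θ.fundamental A p, ← hA, map_sub, hv2, hθ.form_eq_zero hw, sub_self]
  have hvw : v - w = 0 := by
    rw [hA, hA0]
    exact map_zero (fundamentalMap EG G EP p)
  rw [sub_eq_zero.1 hvw]
  exact hw

/-- The transverse metric `π^* g + ⟨θ, θ⟩` defined by a basic connection `θ`. -/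
def connectionMetric (hP : IsFoliatedPrincipalBundle EG G π FP F) (g : F.NormalMetric)
    {θ : PrincipalConnection EG G EP P} (hθ : θ.IsBasic FP) : FP.NormalMetric where
  -- The form descends to the quotient in one argument, is flipped, and descends in the other. The
  -- arguments thus end up exchanged, which symmetry repairs.
  form p := (FP.tangent p).liftQ
    (((FP.tangent p).liftQ (connectionBilin π g θ p) (fun v hv => by
      ext w; exact connectionBilin_eq_zero hP g hθ hv w)).flip) (fun v hv => by
        ext w
        exact (connectionBilin_symm g θ p w v).trans (connectionBilin_eq_zero hP g hθ hv w))
  symm p u v := by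
    induction u using Submodule.Quotient.induction_on with | _ u
    induction v using Submodule.Quotient.induction_on with | _ v
    exact connectionBilin_symm g θ p v u
  pos p u hu := by
    induction u using Submodule.Quotient.induction_on with | _ u
    refine lt_of_le_of_ne (connectionBilin_self_nonneg g θ p u) fun h => hu ?_
    rw [Submodule.Quotient.mk_eq_zero]
    exact mem_tangent_of_connectionBilin_self_eq_zero hP g hθ h.symm
  smooth X Y hX hY := by
    intro p
    have hπ : ∀ X, IsSmoothVectorField X → ContMDiffAt 𝓘(ℝ, EP) 𝓘(ℝ, E).tangent ∞
        (fun p => (⟨π p, mfderiv 𝓘(ℝ, EP) 𝓘(ℝ, E) π p (X p)⟩ : TangentBundle 𝓘(ℝ, E) M)) p :=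
      fun X hX => ContMDiffAt.mfderiv_apply_tangentBundle (N := P) (f := fun _ => π) (g := id)
        (v := X) (hP.principal.smooth_proj.contMDiffAt.comp (p, p) contMDiffAt_snd) (hX p)
    have h1 := ContMDiffAt.bilinForm_along g.lift (fun X Y hX hY => g.smooth X Y hX hY)
      (hπ Y hY) (hπ X hX)
    have h2 : ContMDiffAt 𝓘(ℝ, EP) 𝓘(ℝ, ℝ) ∞
        (fun p => auxInner EG (θ.eval Y p) (θ.eval X p)) p :=
      ((auxInner EG).contMDiff.contMDiffAt.comp p (θ.contMDiff_eval hY p)).clm_apply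
        (θ.contMDiff_eval hX p)
    exact h1.add h2

theorem connectionMetric_lift (hP : IsFoliatedPrincipalBundle EG G π FP F) (g : F.NormalMetric)
    {θ : PrincipalConnection EG G EP P} (hθ : θ.IsBasic FP) (p : P)
    (v w : TangentSpace 𝓘(ℝ, EP) p) :
    (connectionMetric hP g hθ).form p (FP.toNormal p v) (FP.toNormal p w) =
      connectionBilin π g θ p v w := connectionBilin_symm g θ p w v

/-- The Leibniz rule for `L_Z` holds for each summand: for `π^* g` by `lieDeriv_pullback`, for `⟨θ,
θ⟩` because `L_Z θ = 0` and the inner product on `𝔤` is constant. Invariance of that inner product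
under `Ad` is not needed. -/
theorem connectionMetric_isInvariant (hP : IsFoliatedPrincipalBundle EG G π FP F)
    {g : F.NormalMetric} (hg : g.IsInvariant) {θ : PrincipalConnection EG G EP P}
    (hθ : θ.IsBasic FP) : (connectionMetric hP g hθ).IsInvariant := by
  intro Z X Y hZ hX hY p
  simp only [connectionMetric_lift, connectionBilin_apply]
  have hπ : ∀ X, IsSmoothVectorField X → ContMDiffAt 𝓘(ℝ, EP) 𝓘(ℝ, E).tangent ∞
      (fun p => (⟨π p, mfderiv 𝓘(ℝ, EP) 𝓘(ℝ, E) π p (X p)⟩ : TangentBundle 𝓘(ℝ, E) M)) p :=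
    fun X hX => ContMDiffAt.mfderiv_apply_tangentBundle (N := P) (f := fun _ => π) (g := id)
      (v := X) (hP.principal.smooth_proj.contMDiffAt.comp (p, p) contMDiffAt_snd) (hX p)
  have d1 := (ContMDiffAt.bilinForm_along g.lift (fun X Y hX hY => g.smooth X Y hX hY)
    (hπ X hX) (hπ Y hY)).mdifferentiableAt (show (∞ : WithTop ℕ∞) ≠ 0 by simp)
  have dX := (θ.contMDiff_eval hX p).mdifferentiableAt (show (∞ : WithTop ℕ∞) ≠ 0 by simp)
  have dY := (θ.contMDiff_eval hY p).mdifferentiableAt (show (∞ : WithTop ℕ∞) ≠ 0 by simp)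
  have d2 : MDifferentiableAt 𝓘(ℝ, EP) 𝓘(ℝ, ℝ)
      (fun p => auxInner EG (θ.eval X p) (θ.eval Y p)) p :=
    (((auxInner EG).contMDiff.contMDiffAt.comp p (θ.contMDiff_eval hX p)).clm_apply
      (θ.contMDiff_eval hY p)).mdifferentiableAt (by simp)
  have e1 := hg.lieDeriv_pullback hP.principal.smooth_proj hZ.1
    (fun p => hP.mfderiv_mem (hZ.2 p)) hX hY p
  have e2 := dirDeriv_bilin (auxInner EG) dX dY (Z p)
  rw [hθ.dirDeriv_eval hZ hX, hθ.dirDeriv_eval hZ hY] at e2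
  refine (dirDeriv_add d1 d2 (Z p)).trans ?_
  rw [e1, e2]
  simp only [PrincipalConnection.eval]
  ring

end MetricOfConnection

/-- On a finite-dimensional space an operator depends linearly and continuously on its values on a
basis. -/
theorem contMDiffAt_of_clm_apply {EN : Type*} [NormedAddCommGroup EN] [NormedSpace ℝ EN]
    {HN : Type*} [TopologicalSpace HN] {J : ModelWithCorners ℝ EN HN}
    {N : Type*} [TopologicalSpace N] [ChartedSpace HN N]
    {V W : Type*} [NormedAddCommGroup V] [NormedSpace ℝ V] [FiniteDimensional ℝ V]
    [NormedAddCommGroup W] [NormedSpace ℝ W] {f : N → V →L[ℝ] W} {n₀ : N}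
    (hf : ∀ x, ContMDiffAt J 𝓘(ℝ, W) ∞ (fun n => f n x) n₀) :
    ContMDiffAt J 𝓘(ℝ, V →L[ℝ] W) ∞ f n₀ := by
  let c : Fin (Module.finrank ℝ V) → V →L[ℝ] ℝ := fun i =>
    LinearMap.toContinuousLinearMap ((Module.finBasis ℝ V).coord i)
  have : f = fun n => ∑ i, ContinuousLinearMap.smulRightL ℝ V W (c i)
      (f n (Module.finBasis ℝ V i)) := by
    funext n
    ext x
    conv_lhs => rw [← (Module.finBasis ℝ V).sum_repr x, map_sum]
    simp only [FunLike.coe_sum, Finset.sum_apply, map_smul]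
    rfl
  rw [this]
  refine contMDiffAt_finsetSum fun i _ => ?_
  exact (ContinuousLinearMap.contMDiff _).contMDiffAt.comp n₀ (hf _)

/-! ### From an invariant metric to an invariant form: projection onto the vertical directions -/

section BasicForm

variable {E : Type*} [NormedAddCommGroup E] [NormedSpace ℝ E] [FiniteDimensional ℝ E]
  {M : Type*} [TopologicalSpace M] [T2Space M] [ChartedSpace E M] [IsManifold 𝓘(ℝ, E) ∞ M]
  {EG : Type*} [NormedAddCommGroup EG] [NormedSpace ℝ EG] [FiniteDimensional ℝ EG]
  {G : Type*} [TopologicalSpace G] [ChartedSpace EG G] [Group G] [LieGroup 𝓘(ℝ, EG) ∞ G]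
  {EP : Type*} [NormedAddCommGroup EP] [NormedSpace ℝ EP] [FiniteDimensional ℝ EP]
  {P : Type*} [TopologicalSpace P] [T2Space P] [ChartedSpace EP P] [IsManifold 𝓘(ℝ, EP) ∞ P]
  [MulAction Gᵐᵒᵖ P] {π : P → M} {F : SmoothFoliation E M} {FP : SmoothFoliation EP P}

namespace SmoothFoliation.NormalMetric

variable (EG G) in
/-- The scalar product of a tangent vector with the fundamental vector fields. -/
def verticalPart (g : FP.NormalMetric) (p : P) :
    TangentSpace 𝓘(ℝ, EP) p →ₗ[ℝ] EG →L[ℝ] ℝ :=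
  LinearMap.toContinuousLinearMap.toLinearMap ∘ₗ
    (g.lift p).compl₁₂ LinearMap.id (fundamentalMap EG G EP p)

variable (EG G) in
/-- The Gram form of the fundamental vector fields. -/
def gram (g : FP.NormalMetric) (p : P) : EG →L[ℝ] EG →L[ℝ] ℝ :=
  LinearMap.toContinuousLinearMap (verticalPart EG G g p ∘ₗ fundamentalMap EG G EP p)

/-- A kernel element gives a fundamental vector of zero length, hence one in `FP`, hence zero.
Injectivity suffices because `𝔤` and its dual have the same dimension. -/
theorem gram_isInvertible (hP : IsFoliatedPrincipalBundle EG G π FP F) (g : FP.NormalMetric)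
    (p : P) : (gram EG G g p).IsInvertible := by
  have hinj : Function.Injective (gram EG G g p).toLinearMap := by
    rw [injective_iff_map_eq_zero]
    intro A hA
    refine hP.eq_zero_of_fundamentalField_mem (p := p) (g.mem_tangent_of_lift_self_eq_zero ?_)
    exact congrArg (fun L : EG →L[ℝ] ℝ => L A) hA
  have hdim : Module.finrank ℝ EG = Module.finrank ℝ (EG →L[ℝ] ℝ) := by
    rw [← (LinearMap.toContinuousLinearMap (𝕜 := ℝ) (E := EG) (F' := ℝ)).finrank_eq]
    exact (Subspace.dual_finrank_eq (K := ℝ) (V := EG)).symm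
  refine ⟨(LinearEquiv.ofInjectiveOfFinrankEq _ hinj hdim).toContinuousLinearEquiv, ?_⟩
  ext A
  rfl

variable (EG G) in
/-- The vertical part of a tangent vector, in terms of the orthogonal decomposition of the normal
space into the vertical directions and their complement. -/
def basicForm (g : FP.NormalMetric) (p : P) : TangentSpace 𝓘(ℝ, EP) p →ₗ[ℝ] EG :=
  (gram EG G g p).inverse.toLinearMap ∘ₗ verticalPart EG G g p

theorem basicForm_apply (g : FP.NormalMetric) (p : P) (v : TangentSpace 𝓘(ℝ, EP) p) :
    basicForm EG G g p v = (gram EG G g p).inverse (verticalPart EG G g p v) := rfl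

theorem gram_basicForm (hP : IsFoliatedPrincipalBundle EG G π FP F) (g : FP.NormalMetric)
    (p : P) (v : TangentSpace 𝓘(ℝ, EP) p) :
    gram EG G g p (basicForm EG G g p v) = verticalPart EG G g p v :=
  (gram_isInvertible hP g p).self_apply_inverse _

theorem basicForm_eq_iff (hP : IsFoliatedPrincipalBundle EG G π FP F) (g : FP.NormalMetric)
    {p : P} {v : TangentSpace 𝓘(ℝ, EP) p} {A : EG} :
    A = basicForm EG G g p v ↔ gram EG G g p A = verticalPart EG G g p v := by
  rw [← gram_basicForm hP g p v]
  exact ((gram_isInvertible hP g p).injective.eq_iff).symm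

theorem basicForm_fundamentalField (hP : IsFoliatedPrincipalBundle EG G π FP F)
    (g : FP.NormalMetric) (p : P) (A : EG) :
    basicForm EG G g p (fundamentalMap EG G EP p A) = A := by
  rw [eq_comm, basicForm_eq_iff hP]
  rfl

theorem basicForm_eq_zero (g : FP.NormalMetric) {p : P} {v : TangentSpace 𝓘(ℝ, EP) p}
    (hv : v ∈ FP.tangent p) : basicForm EG G g p v = 0 := by
  have : verticalPart EG G g p v = 0 := by
    ext B
    exact g.lift_eq_zero hv _
  rw [basicForm_apply, this, map_zero]

theorem contMDiff_gram (hP : IsFoliatedPrincipalBundle EG G π FP F) (g : FP.NormalMetric) :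
    ContMDiff 𝓘(ℝ, EP) 𝓘(ℝ, EG →L[ℝ] EG →L[ℝ] ℝ) ∞ (gram EG G g) := fun p =>
  contMDiffAt_of_clm_apply fun A => contMDiffAt_of_clm_apply fun B =>
    g.smooth _ _ (hP.principal.isSmoothVectorField_fundamentalField A)
      (hP.principal.isSmoothVectorField_fundamentalField B) p

theorem contMDiff_verticalPart (hP : IsFoliatedPrincipalBundle EG G π FP F) (g : FP.NormalMetric)
    {X : ∀ p : P, TangentSpace 𝓘(ℝ, EP) p} (hX : IsSmoothVectorField X) :
    ContMDiff 𝓘(ℝ, EP) 𝓘(ℝ, EG →L[ℝ] ℝ) ∞ (fun p => verticalPart EG G g p (X p)) := fun p =>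
  contMDiffAt_of_clm_apply fun B =>
    g.smooth _ _ hX (hP.principal.isSmoothVectorField_fundamentalField B) p

theorem contMDiff_basicForm (hP : IsFoliatedPrincipalBundle EG G π FP F) (g : FP.NormalMetric)
    {X : ∀ p : P, TangentSpace 𝓘(ℝ, EP) p} (hX : IsSmoothVectorField X) :
    ContMDiff 𝓘(ℝ, EP) 𝓘(ℝ, EG) ∞ (fun p => basicForm EG G g p (X p)) := by
  intro p
  obtain ⟨e, he⟩ := gram_isInvertible hP g p
  have h1 : ContMDiffAt 𝓘(ℝ, EP) 𝓘(ℝ, (EG →L[ℝ] ℝ) →L[ℝ] EG) ∞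
      (fun p => (gram EG G g p).inverse) p := by
    -- Inversion of operators is smooth near an invertible one, so the inverse Gram form is smooth
    -- in `p`.
    have := contDiffAt_map_inverse (n := ∞) e
    rw [he] at this
    exact this.contMDiffAt.comp p (contMDiff_gram hP g p)
  exact h1.clm_apply (contMDiff_verticalPart hP g hX p)

/-- This is `L_Z β = 0`. The relation `gram(β(Y)) = g(Y, ·)` is differentiated along `Z`. Since `[Z,
A_P]` is tangent to `FP`, invariance of the metric makes `gram` constant along `Z` and carries the
derivative of the right side entirely onto `Y`. -/
theorem IsInvariant.dirDeriv_basicForm {g : FP.NormalMetric} (hg : g.IsInvariant)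
    (hP : IsFoliatedPrincipalBundle EG G π FP F) {Z Y : ∀ p : P, TangentSpace 𝓘(ℝ, EP) p}
    (hZ : FP.IsTangentField Z) (hY : IsSmoothVectorField Y) (p : P) :
    dirDeriv (fun q => basicForm EG G g q (Y q)) p (Z p) =
      basicForm EG G g p (mlieBracket 𝓘(ℝ, EP) Z Y p) := by
  rw [basicForm_eq_iff hP]
  have hfun : ∀ A : EG, (fun q => fundamentalMap EG G EP q A) =
      fundamentalField (EG := EG) (G := G) (EP := EP) (P := P) A := fun A => rfl
  have hbr : ∀ (A : EG) (w : TangentSpace 𝓘(ℝ, EP) p), g.lift p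
      (mlieBracket 𝓘(ℝ, EP) Z (fun q => fundamentalMap EG G EP q A) p) w = 0 := fun A w =>
    g.lift_eq_zero (hP.mlieBracket_fundamentalField_mem g hZ A p) w
  have hgram := (contMDiff_gram hP g p).mdifferentiableAt (show (∞ : WithTop ℕ∞) ≠ 0 by simp)
  have hform := (contMDiff_basicForm hP g hY p).mdifferentiableAt
    (show (∞ : WithTop ℕ∞) ≠ 0 by simp)
  have hvert := (contMDiff_verticalPart (EG := EG) (G := G) hP g hY p).mdifferentiableAt
    (show (∞ : WithTop ℕ∞) ≠ 0 by simp)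
  have hgram0 : dirDeriv (gram EG G g) p (Z p) = 0 := by
    ext A B
    have h1 := dirDeriv_clm ((ContinuousLinearMap.apply ℝ ℝ B).comp
      (ContinuousLinearMap.apply ℝ (EG →L[ℝ] ℝ) A)) hgram (Z p)
    have h2 := hg Z (fundamentalField (EG := EG) (G := G) A)
      (fundamentalField (EG := EG) (G := G) B) hZ
      (hP.principal.isSmoothVectorField_fundamentalField A)
      (hP.principal.isSmoothVectorField_fundamentalField B) p
    refine h1.symm.trans (h2.trans ?_)
    have h3 := hbr A (fundamentalMap EG G EP p B)
    have h4 := hbr B (fundamentalMap EG G EP p A)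
    rw [g.lift_symm] at h4
    exact (congrArg₂ (· + ·) h3 h4).trans (add_zero _)
  have hvert' : dirDeriv (fun q => verticalPart EG G g q (Y q)) p (Z p) =
      verticalPart EG G g p (mlieBracket 𝓘(ℝ, EP) Z Y p) := by
    ext B
    have h1 := dirDeriv_clm (ContinuousLinearMap.apply ℝ ℝ B) hvert (Z p)
    have h2 := hg Z Y (fundamentalField (EG := EG) (G := G) B) hZ hY
      (hP.principal.isSmoothVectorField_fundamentalField B) p
    refine h1.symm.trans (h2.trans ?_)
    have h4 := hbr B (Y p)
    rw [g.lift_symm] at h4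
    exact (congrArg₂ (· + ·) rfl h4).trans (add_zero _)
  have h := dirDeriv_clm_apply hgram hform (Z p)
  rw [hgram0, zero_apply, zero_add] at h
  rw [← hvert', ← h]
  congr 1
  funext q
  exact gram_basicForm hP g q (Y q)

end SmoothFoliation.NormalMetric

end BasicForm

/-! ### Smoothness of integrals over a compact manifold of parameters -/

section ParametricIntegral

open MeasureTheory

variable {E : Type*} [NormedAddCommGroup E] [NormedSpace ℝ E] [FiniteDimensional ℝ E]
  {EG : Type*} [NormedAddCommGroup EG] [NormedSpace ℝ EG]
  {G : Type*} [TopologicalSpace G] [CompactSpace G] [ChartedSpace EG G]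
  [IsManifold 𝓘(ℝ, EG) ∞ G] [MeasurableSpace G] [BorelSpace G]
  {V : Type*} [NormedAddCommGroup V] [NormedSpace ℝ V] [FiniteDimensional ℝ V]
  {μ : Measure G} [IsFiniteMeasure μ] {U : Set E} {f : E → G → V}

theorem Continuous.integrable_of_compactSpace {W : Type*} [NormedAddCommGroup W] {u : G → W}
    (hu : Continuous u) : Integrable u μ :=
  hu.integrable_of_hasCompactSupport (HasCompactSupport.of_compactSpace u)

theorem contMDiff_tangentBundle_const (y : E) :
    ContMDiff 𝓘(ℝ, E) 𝓘(ℝ, E).tangent ∞ (fun x : E => (⟨x, y⟩ : TangentBundle 𝓘(ℝ, E) E)) := by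
  exact contMDiff_vectorSpace_iff_contDiff.2 contDiff_const

theorem contMDiffAt_fderiv_apply_of_uncurry {z : E × G}
    (hf : ContMDiffAt (𝓘(ℝ, E).prod 𝓘(ℝ, EG)) 𝓘(ℝ, V) ∞ (Function.uncurry f) z) (y : E) :
    ContMDiffAt (𝓘(ℝ, E).prod 𝓘(ℝ, EG)) 𝓘(ℝ, V) ∞
      (Function.uncurry fun x g => fderiv ℝ (fun x => f x g) x y) z := by
  have h := ContMDiffAt.mfderiv_apply_vectorSpace (J := 𝓘(ℝ, E).prod 𝓘(ℝ, EG)) (N := E × G)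
    (I := 𝓘(ℝ, E)) (f := fun (n : E × G) (x : E) => f x n.2) (g := fun n => n.1) (v := fun _ => y)
    (n₀ := z)
    (ContMDiffAt.comp (f := fun a : (E × G) × E => (a.2, a.1.2)) (z, z.1) hf
      (contMDiffAt_snd.prodMk (contMDiff_snd.comp contMDiff_fst).contMDiffAt))
    ((contMDiff_tangentBundle_const y).contMDiffAt.comp z contMDiffAt_fst)
  refine h.congr_of_eventuallyEq (Eventually.of_forall fun n => ?_)
  simp only [Function.uncurry_def, mfderiv_eq_fderiv]
  rfl

theorem hasFDerivAt_integral_of_contMDiffOn (hU : IsOpen U)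
    (hf : ∀ x ∈ U, ∀ g, ContMDiffAt (𝓘(ℝ, E).prod 𝓘(ℝ, EG)) 𝓘(ℝ, V) ∞ (Function.uncurry f) (x, g))
    {x : E} (hx : x ∈ U) :
    HasFDerivAt (fun x => ∫ g, f x g ∂μ) (∫ g, fderiv ℝ (fun x => f x g) x ∂μ) x ∧
      ∀ y, (∫ g, fderiv ℝ (fun x => f x g) x ∂μ) y = ∫ g, fderiv ℝ (fun x => f x g) x y ∂μ := by
  have hD : ∀ x ∈ U, ∀ g, ContMDiffAt (𝓘(ℝ, E).prod 𝓘(ℝ, EG)) 𝓘(ℝ, E →L[ℝ] V) ∞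
      (Function.uncurry fun x g => fderiv ℝ (fun x => f x g) x) (x, g) := fun x hx g =>
    contMDiffAt_of_clm_apply fun y => contMDiffAt_fderiv_apply_of_uncurry (hf x hx g) y
  have hcf : ∀ x ∈ U, Continuous (f x) := fun x hx => continuous_iff_continuousAt.2 fun g =>
    ContinuousAt.comp (f := fun g => (x, g)) (hf x hx g).continuousAt (by fun_prop)
  have hcD : ∀ x ∈ U, Continuous fun g => fderiv ℝ (fun x => f x g) x := fun x hx =>
    continuous_iff_continuousAt.2 fun g =>
      ContinuousAt.comp (f := fun g => (x, g)) (hD x hx g).continuousAt (by fun_prop)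
  have hdiff : ∀ x ∈ U, ∀ g, DifferentiableAt ℝ (fun x => f x g) x := fun x hx g =>
    ((hf x hx g).comp x (contMDiffAt_id.prodMk contMDiffAt_const)).contDiffAt.differentiableAt
      (by simp)
  obtain ⟨r, hr, hrU⟩ := Metric.nhds_basis_closedBall.mem_iff.1 (hU.mem_nhds hx)
  -- Compactness of `G` provides a bound for the derivative uniform in both variables. Being
  -- constant, it is integrable for a finite measure and serves as the dominating function.
  have hK : IsCompact (Metric.closedBall x r ×ˢ (Set.univ : Set G)) :=
    (isCompact_closedBall x r).prod isCompact_univ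
  obtain ⟨C, hC⟩ := hK.exists_bound_of_continuousOn
    (f := Function.uncurry fun x g => fderiv ℝ (fun x => f x g) x)
    (fun z hz => (hD z.1 (hrU hz.1) z.2).continuousAt.continuousWithinAt)
  refine ⟨?_, fun y => (ContinuousLinearMap.integral_apply (hcD x hx).integrable_of_compactSpace y)⟩
  refine hasFDerivAt_integral_of_dominated_of_fderiv_le
    (F' := fun x g => fderiv ℝ (fun x => f x g) x) (bound := fun _ => C)
    (Metric.closedBall_mem_nhds x hr) ?_ (hcf x hx).integrable_of_compactSpace
    (hcD x hx).integrable_of_compactSpace.aestronglyMeasurable ?_ (integrable_const C) ?_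
  · filter_upwards [hU.mem_nhds hx] with x' hx'
    exact (hcf x' hx').integrable_of_compactSpace.aestronglyMeasurable
  · exact Eventually.of_forall fun g x' hx' => hC (x', g) ⟨hx', trivial⟩
  · exact Eventually.of_forall fun g x' hx' => (hdiff x' (hrU hx') g).hasFDerivAt

/-- Induction on the order, with `f` arbitrary: the derivative of the integral in a fixed direction
is the integral of a family of the same kind. -/
theorem contDiffOn_integral_of_contMDiffOn (hU : IsOpen U)
    (hf : ∀ x ∈ U, ∀ g, ContMDiffAt (𝓘(ℝ, E).prod 𝓘(ℝ, EG)) 𝓘(ℝ, V) ∞ (Function.uncurry f) (x, g)) :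
    ContDiffOn ℝ ∞ (fun x => ∫ g, f x g ∂μ) U := by
  rw [contDiffOn_infty]
  intro n
  induction n generalizing f with
  | zero =>
    rw [Nat.cast_zero, contDiffOn_zero]
    exact fun x hx =>
      (hasFDerivAt_integral_of_contMDiffOn hU hf hx).1.continuousAt.continuousWithinAt
  | succ n ih =>
    rw [Nat.cast_succ, contDiffOn_succ_iff_fderiv_apply hU.uniqueDiffOn]
    refine ⟨fun x hx => (hasFDerivAt_integral_of_contMDiffOn hU hf hx).1.differentiableAt
      |>.differentiableWithinAt, fun h => by simp at h, fun y => ?_⟩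
    refine (ih (f := fun x g => fderiv ℝ (fun x => f x g) x y) fun x hx g =>
      contMDiffAt_fderiv_apply_of_uncurry (hf x hx g) y).congr fun x hx => ?_
    have h := hasFDerivAt_integral_of_contMDiffOn (μ := μ) hU hf hx
    rw [fderivWithin_of_isOpen hU hx, h.1.fderiv, h.2]

variable {P : Type*} [TopologicalSpace P] [ChartedSpace E P] [IsManifold 𝓘(ℝ, E) ∞ P]
  {k : P → G → V}

theorem ContMDiff.uncurry_comp_extChartAt_symm
    (hk : ContMDiff (𝓘(ℝ, E).prod 𝓘(ℝ, EG)) 𝓘(ℝ, V) ∞ (Function.uncurry k)) (p : P) :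
    ∀ x ∈ (extChartAt 𝓘(ℝ, E) p).target, ∀ g, ContMDiffAt (𝓘(ℝ, E).prod 𝓘(ℝ, EG)) 𝓘(ℝ, V) ∞
      (Function.uncurry fun x g => k ((extChartAt 𝓘(ℝ, E) p).symm x) g) (x, g) := by
  intro x hx g
  have h := (contMDiffOn_extChartAt_symm (I := 𝓘(ℝ, E)) (n := ∞) p).contMDiffAt
      ((isOpen_extChartAt_target p).mem_nhds hx)
  exact ContMDiffAt.comp (g := Function.uncurry k)
    (f := fun z : E × G => ((extChartAt 𝓘(ℝ, E) p).symm z.1, z.2)) (x, g) hk.contMDiffAt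
    ((h.comp (x, g) contMDiffAt_fst).prodMk contMDiffAt_snd)

/-- The integral of a smooth family of functions over a compact manifold is smooth. -/
theorem ContMDiff.integral
    (hk : ContMDiff (𝓘(ℝ, E).prod 𝓘(ℝ, EG)) 𝓘(ℝ, V) ∞ (Function.uncurry k)) :
    ContMDiff 𝓘(ℝ, E) 𝓘(ℝ, V) ∞ (fun p => ∫ g, k p g ∂μ) := by
  intro p
  have h := (contDiffOn_integral_of_contMDiffOn (μ := μ) (isOpen_extChartAt_target p)
    (hk.uncurry_comp_extChartAt_symm p)).contDiffAt
      ((isOpen_extChartAt_target p).mem_nhds (mem_extChartAt_target p))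
  refine (h.contMDiffAt.comp p contMDiffAt_extChartAt).congr_of_eventuallyEq ?_
  filter_upwards [extChartAt_source_mem_nhds (I := 𝓘(ℝ, E)) p] with q hq
  simp only [Function.comp_apply]
  rw [(extChartAt 𝓘(ℝ, E) p).left_inv hq]

/-- Differentiation under the integral sign, over a compact manifold of parameters. -/
theorem dirDeriv_integral
    (hk : ContMDiff (𝓘(ℝ, E).prod 𝓘(ℝ, EG)) 𝓘(ℝ, V) ∞ (Function.uncurry k)) (p : P)
    (v : TangentSpace 𝓘(ℝ, E) p) :
    dirDeriv (fun p => ∫ g, k p g ∂μ) p v = ∫ g, dirDeriv (fun p => k p g) p v ∂μ := by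
  have h := hasFDerivAt_integral_of_contMDiffOn (μ := μ) (isOpen_extChartAt_target p)
    (hk.uncurry_comp_extChartAt_symm p) (mem_extChartAt_target p)
  rw [dirDeriv_eq_fderiv (hk.integral.mdifferentiableAt (by simp))]
  refine (congrArg (fun L : E →L[ℝ] V => L v) h.1.fderiv).trans ((h.2 v).trans ?_)
  refine integral_congr_ae (Eventually.of_forall fun g => ?_)
  have hkg : ContMDiff 𝓘(ℝ, E) 𝓘(ℝ, V) ∞ (fun p => k p g) :=
    hk.comp (contMDiff_id.prodMk contMDiff_const)
  exact (dirDeriv_eq_fderiv (hkg.mdifferentiableAt (by simp)) v).symm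

end ParametricIntegral

/-! ### The adjoint action and its smoothness -/

section AdjointAction

variable {EG : Type*} [NormedAddCommGroup EG] [NormedSpace ℝ EG]
  {G : Type*} [TopologicalSpace G] [ChartedSpace EG G] [Group G] [LieGroup 𝓘(ℝ, EG) ∞ G]

variable (EG) in
/-- The adjoint action of a group element, as a continuous linear map. -/
def adjointMap (g : G) : EG →L[ℝ] EG :=
  mfderiv 𝓘(ℝ, EG) 𝓘(ℝ, EG) (fun h : G => g * h * g⁻¹) 1

theorem mdifferentiableAt_conj (g h : G) :
    MDifferentiableAt 𝓘(ℝ, EG) 𝓘(ℝ, EG) (fun h : G => g * h * g⁻¹) h :=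
  (((contMDiff_mul_right (I := 𝓘(ℝ, EG)) (n := ∞) (a := g⁻¹)).comp
    (contMDiff_mul_left (I := 𝓘(ℝ, EG)) (n := ∞) (a := g))).mdifferentiableAt (by simp))

theorem adjointMap_mul (g h : G) (A : EG) :
    adjointMap EG (g * h) A = adjointMap EG g (adjointMap EG h A) := by
  have h1 := mfderiv_comp_apply_of_eq (x := (1 : G)) (y := (1 : G))
    (mdifferentiableAt_conj (EG := EG) g 1) (mdifferentiableAt_conj (EG := EG) h 1) (by simp) A
  have hfun : (fun k : G => g * k * g⁻¹) ∘ (fun k : G => h * k * h⁻¹) =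
      fun k : G => g * h * k * (g * h)⁻¹ := by
    funext k
    simp [mul_assoc]
  rw [hfun] at h1
  exact h1

theorem adjointMap_one (A : EG) : adjointMap EG (1 : G) A = A := by
  have hfun : (fun h : G => 1 * h * 1⁻¹) = id := by
    funext h
    simp
  rw [adjointMap, hfun, mfderiv_id]
  rfl

theorem dirDeriv_extChartAt_of_eq {EP : Type*} [NormedAddCommGroup EP] [NormedSpace ℝ EP]
    {P : Type*} [TopologicalSpace P] [ChartedSpace EP P]
    {f : P → G} {p : P} (hf : MDifferentiableAt 𝓘(ℝ, EP) 𝓘(ℝ, EG) f p) {g : G} (hg : f p = g)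
    (v : TangentSpace 𝓘(ℝ, EP) p) :
    dirDeriv (fun q => extChartAt 𝓘(ℝ, EG) g (f q)) p v =
      (mfderiv 𝓘(ℝ, EP) 𝓘(ℝ, EG) f p v : EG) := by
  subst hg
  have : IsManifold 𝓘(ℝ, EG) 1 G := .of_le (n := ∞) (by simp)
  have hφ : MDifferentiableAt 𝓘(ℝ, EG) 𝓘(ℝ, EG) (extChartAt 𝓘(ℝ, EG) (f p)) (f p) :=
    mdifferentiableAt_extChartAt (mem_chart_source _ _)
  exact (congrArg (fun L : EP →L[ℝ] EG => L v) (hφ.comp p hf).mfderiv).trans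
    (congrArg (fun L : EP →L[ℝ] EG => L v) hf.mfderiv.symm)

/-- Conjugation fixes the identity of `G`, so composing with the chart there makes the map
vector-valued near the identity without changing its derivative at that point. Smooth dependence of
partial derivatives on parameters then applies. -/
theorem contMDiffAt_adjointMap_apply {EN : Type*} [NormedAddCommGroup EN] [NormedSpace ℝ EN]
    {HN : Type*} [TopologicalSpace HN] {J : ModelWithCorners ℝ EN HN}
    {N : Type*} [TopologicalSpace N] [ChartedSpace HN N] [IsManifold J ∞ N]
    {γ : N → G} {B : N → EG} {n₀ : N} (hγ : ContMDiffAt J 𝓘(ℝ, EG) ∞ γ n₀)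
    (hB : ContMDiffAt J 𝓘(ℝ, EG) ∞ B n₀) :
    ContMDiffAt J 𝓘(ℝ, EG) ∞ (fun n => adjointMap EG (γ n) (B n)) n₀ := by
  have : IsManifold 𝓘(ℝ, EG) 1 G := .of_le (n := ∞) (by simp)
  have hB' : ContMDiffAt J 𝓘(ℝ, EG).tangent ∞
      (fun n => (⟨(1 : G), B n⟩ : TangentBundle 𝓘(ℝ, EG) G)) n₀ := by
    rw [Bundle.contMDiffAt_totalSpace]
    refine ⟨contMDiffAt_const, hB.congr_of_eventuallyEq (Eventually.of_forall fun n => ?_)⟩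
    exact tangentCoordChange_self (I := 𝓘(ℝ, EG)) (mem_extChartAt_source (1 : G))
  have hf : ContMDiffAt (J.prod 𝓘(ℝ, EG)) 𝓘(ℝ, EG) ∞
      (Function.uncurry fun (n : N) (h : G) => extChartAt 𝓘(ℝ, EG) (1 : G) (γ n * h * (γ n)⁻¹))
      (n₀, 1) := by
    have h1 : ContMDiffAt (J.prod 𝓘(ℝ, EG)) 𝓘(ℝ, EG) ∞
        (fun z : N × G => γ z.1 * z.2 * (γ z.1)⁻¹) (n₀, 1) := by
      have h2 : ContMDiffAt (J.prod 𝓘(ℝ, EG)) 𝓘(ℝ, EG) ∞ (fun z : N × G => γ z.1) (n₀, 1) :=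
        hγ.comp (n₀, (1 : G)) contMDiffAt_fst
      exact (h2.mul contMDiffAt_snd).mul h2.inv
    refine ContMDiffAt.comp_of_eq (y := (1 : G)) (g := extChartAt 𝓘(ℝ, EG) (1 : G))
      contMDiffAt_extChartAt h1 (by simp)
  refine (hf.mfderiv_apply_vectorSpace hB').congr_of_eventuallyEq (Eventually.of_forall fun n => ?_)
  exact (dirDeriv_extChartAt_of_eq (mdifferentiableAt_conj (γ n) 1) (by simp) (B n)).symm

end AdjointAction

/-! ### Averaging over the structure group -/

section Averaging

open MeasureTheory

variable {E : Type*} [NormedAddCommGroup E] [NormedSpace ℝ E]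
  {M : Type*} [TopologicalSpace M] [ChartedSpace E M] [IsManifold 𝓘(ℝ, E) ∞ M]
  {EG : Type*} [NormedAddCommGroup EG] [NormedSpace ℝ EG] [FiniteDimensional ℝ EG]
  {G : Type*} [TopologicalSpace G] [ChartedSpace EG G] [Group G] [LieGroup 𝓘(ℝ, EG) ∞ G]
  {EP : Type*} [NormedAddCommGroup EP] [NormedSpace ℝ EP] [FiniteDimensional ℝ EP]
  {P : Type*} [TopologicalSpace P] [T2Space P] [ChartedSpace EP P] [IsManifold 𝓘(ℝ, EP) ∞ P]
  [MulAction Gᵐᵒᵖ P] {π : P → M} {F : SmoothFoliation E M} {FP : SmoothFoliation EP P}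

variable (G) in
/-- The transform `Ad(g) R_g^* β` of a Lie algebra valued one-form `β`. -/
def conjForm (β : ∀ p : P, TangentSpace 𝓘(ℝ, EP) p →ₗ[ℝ] EG) (p : P)
    (v : TangentSpace 𝓘(ℝ, EP) p) (g : G) : EG :=
  adjointMap EG g (β (MulOpposite.op g • p) (rightTranslationDeriv EP g p v))

theorem conjForm_add (β : ∀ p : P, TangentSpace 𝓘(ℝ, EP) p →ₗ[ℝ] EG) (p : P)
    (v w : TangentSpace 𝓘(ℝ, EP) p) (g : G) :
    conjForm G β p (v + w) g = conjForm G β p v g + conjForm G β p w g := by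
  simp only [conjForm, map_add]

theorem conjForm_smul (β : ∀ p : P, TangentSpace 𝓘(ℝ, EP) p →ₗ[ℝ] EG) (p : P) (c : ℝ)
    (v : TangentSpace 𝓘(ℝ, EP) p) (g : G) :
    conjForm G β p (c • v) g = c • conjForm G β p v g := by
  simp only [conjForm, map_smul]

variable {β : ∀ p : P, TangentSpace 𝓘(ℝ, EP) p →ₗ[ℝ] EG}

theorem IsSmoothPrincipalBundle.contMDiff_conjForm (hP : IsSmoothPrincipalBundle E EG G EP π)
    (hβ : ∀ X : ∀ p : P, TangentSpace 𝓘(ℝ, EP) p, IsSmoothVectorField X →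
      ContMDiff 𝓘(ℝ, EP) 𝓘(ℝ, EG) ∞ fun p => β p (X p))
    {X : ∀ p : P, TangentSpace 𝓘(ℝ, EP) p} (hX : IsSmoothVectorField X) :
    ContMDiff (𝓘(ℝ, EP).prod 𝓘(ℝ, EG)) 𝓘(ℝ, EG) ∞
      (Function.uncurry fun (p : P) (g : G) => conjForm G β p (X p) g) := by
  intro z
  have h1 := ContMDiffAt.mfderiv_apply_tangentBundle (J := 𝓘(ℝ, EP).prod 𝓘(ℝ, EG))
    (I := 𝓘(ℝ, EP)) (I' := 𝓘(ℝ, EP)) (f := fun (n : P × G) (p : P) => MulOpposite.op n.2 • p)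
    (g := fun n => n.1) (v := fun n => X n.1) (n₀ := z)
    ((hP.smooth_action.comp (contMDiff_snd.prodMk (contMDiff_snd.comp contMDiff_fst))).contMDiffAt)
    (ContMDiffAt.comp z hX.contMDiffAt contMDiffAt_fst)
  exact contMDiffAt_adjointMap_apply contMDiffAt_snd (ContMDiffAt.linearForm_along β hβ h1)

theorem IsSmoothPrincipalBundle.continuous_conjForm (hP : IsSmoothPrincipalBundle E EG G EP π)
    (hβ : ∀ X : ∀ p : P, TangentSpace 𝓘(ℝ, EP) p, IsSmoothVectorField X →
      ContMDiff 𝓘(ℝ, EP) 𝓘(ℝ, EG) ∞ fun p => β p (X p)) (p : P)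
    (v : TangentSpace 𝓘(ℝ, EP) p) : Continuous (conjForm G β p v) := by
  obtain ⟨X, hX, rfl⟩ := exists_isSmoothVectorField_eq v
  exact (hP.contMDiff_conjForm hβ hX).continuous.comp (Continuous.prodMk_right p)

/-- `R_g` carries the fundamental vector of `A` to that of `Ad(g⁻¹)A`, and the outer `Ad(g)` undoes
this. -/
theorem IsSmoothPrincipalBundle.conjForm_fundamentalField
    (hP : IsSmoothPrincipalBundle E EG G EP π)
    (hβ : ∀ p A, β p (fundamentalMap EG G EP p A) = A) (p : P) (A : EG) (g : G) :
    conjForm G β p (fundamentalMap EG G EP p A) g = A := by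
  have h1 : conjForm G β p (fundamentalMap EG G EP p A) g =
      adjointMap EG g (β (MulOpposite.op g • p)
        (fundamentalMap EG G EP (MulOpposite.op g • p) (adjointMap EG g⁻¹ A))) :=
    congrArg (fun w => adjointMap EG g (β (MulOpposite.op g • p) w))
      (hP.rightTranslationDeriv_fundamentalField g A p)
  rw [h1, hβ, ← adjointMap_mul, mul_inv_cancel, adjointMap_one]

/-- For a right action `R_g ∘ R_h = R_{hg}`, and `Ad(g) = Ad(h⁻¹) Ad(hg)`. Translating the argument
by `h` thus becomes a left translation of the integration variable. -/
theorem IsSmoothPrincipalBundle.conjForm_rightTranslationDeriv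
    (hP : IsSmoothPrincipalBundle E EG G EP π) (h : G) (p : P) (v : TangentSpace 𝓘(ℝ, EP) p)
    (g : G) :
    conjForm G β (MulOpposite.op h • p) (rightTranslationDeriv EP h p v) g =
      adjointMap EG h⁻¹ (conjForm G β p v (h * g)) := by
  have h1 := mfderiv_comp_apply (x := p)
    ((hP.contMDiff_smul_left g).mdifferentiableAt (x := MulOpposite.op h • p) (by simp))
    ((hP.contMDiff_smul_left h).mdifferentiableAt (x := p) (by simp)) v
  have hfun : (fun q : P => MulOpposite.op g • q) ∘ (fun q : P => MulOpposite.op h • q) =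
      fun q : P => MulOpposite.op (h * g) • q := by
    funext q
    simp [smul_smul]
  rw [hfun] at h1
  -- The base points `(p · h) · g` and `p · (hg)` are only propositionally equal, so the vectors are
  -- compared in the total space before `β` is applied.
  have h2 : (⟨MulOpposite.op g • MulOpposite.op h • p, rightTranslationDeriv EP g _
      (rightTranslationDeriv EP h p v)⟩ : TangentBundle 𝓘(ℝ, EP) P) =
      ⟨MulOpposite.op (h * g) • p, rightTranslationDeriv EP (h * g) p v⟩ :=
    (TangentBundle.mk_congr (congrFun hfun p) _).trans
      (congrArg (fun w : EP => (⟨MulOpposite.op (h * g) • p, w⟩ : TangentBundle 𝓘(ℝ, EP) P))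
        h1.symm)
  have h3 := congrArg (fun w : TangentBundle 𝓘(ℝ, EP) P => β w.1 w.2) h2
  rw [conjForm, conjForm, ← adjointMap_mul, inv_mul_cancel_left]
  exact congrArg (adjointMap EG g) h3

theorem IsFoliatedPrincipalBundle.rightTranslationDeriv_mem
    (hP : IsFoliatedPrincipalBundle EG G π FP F) (g : G) {p : P} {v : TangentSpace 𝓘(ℝ, EP) p}
    (hv : v ∈ FP.tangent p) :
    rightTranslationDeriv EP g p v ∈ FP.tangent (MulOpposite.op g • p) := by
  rw [← hP.invariant g p]
  exact Submodule.mem_map_of_mem hv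

theorem IsFoliatedPrincipalBundle.conjForm_eq_zero (hP : IsFoliatedPrincipalBundle EG G π FP F)
    (hβ : ∀ p, ∀ v ∈ FP.tangent p, β p v = 0) {p : P} {v : TangentSpace 𝓘(ℝ, EP) p}
    (hv : v ∈ FP.tangent p) (g : G) : conjForm G β p v g = 0 := by
  rw [conjForm, hβ _ _ (hP.rightTranslationDeriv_mem g hv), map_zero]

theorem IsSmoothPrincipalBundle.inverse_mfderiv_smul (hP : IsSmoothPrincipalBundle E EG G EP π)
    (g : G) (p : P) :
    ((mfderiv 𝓘(ℝ, EP) 𝓘(ℝ, EP) (fun q : P => MulOpposite.op g⁻¹ • q)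
      (MulOpposite.op g • p)).inverse : EP →L[ℝ] EP) =
      (rightTranslationDeriv EP g p : EP →L[ℝ] EP) ∧
    (mfderiv 𝓘(ℝ, EP) 𝓘(ℝ, EP) (fun q : P => MulOpposite.op g⁻¹ • q)
      (MulOpposite.op g • p)).IsInvertible := by
  have hR := fun (g : G) (q : P) =>
    (hP.contMDiff_smul_left g).mdifferentiableAt (x := q) (by simp)
  have h1 := mfderiv_comp_of_eq (x := p) (y := MulOpposite.op g • p) (hR g⁻¹ _) (hR g p) rfl
  have h2 := fun v => mfderiv_comp_apply_of_eq (x := MulOpposite.op g • p) (y := p) (hR g p)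
    (hR g⁻¹ (MulOpposite.op g • p)) (by simp) v
  have e1 : (fun q : P => MulOpposite.op g⁻¹ • q) ∘ (fun q : P => MulOpposite.op g • q) = id := by
    funext q; simp
  have e2 : (fun q : P => MulOpposite.op g • q) ∘ (fun q : P => MulOpposite.op g⁻¹ • q) = id := by
    funext q; simp
  rw [e1, mfderiv_id] at h1
  rw [e2, mfderiv_id] at h2
  let A : EP →L[ℝ] EP := mfderiv 𝓘(ℝ, EP) 𝓘(ℝ, EP) (fun q : P => MulOpposite.op g⁻¹ • q)
      (MulOpposite.op g • p)
  let B : EP →L[ℝ] EP := rightTranslationDeriv EP g p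
  have hAB : A ∘L B = ContinuousLinearMap.id ℝ EP := h1.symm
  have hBA : B ∘L A = ContinuousLinearMap.id ℝ EP :=
    ContinuousLinearMap.ext fun v => (h2 v).symm
  exact ⟨ContinuousLinearMap.inverse_eq (f := A) (g := B) hAB hBA,
    ContinuousLinearMap.IsInvertible.of_inverse (f := A) (g := B) hAB hBA⟩

variable (EP) in
/-- The push-forward of a vector field by the right translation by `g`. -/
def translateField (g : G) (X : ∀ p : P, TangentSpace 𝓘(ℝ, EP) p) :
    ∀ p : P, TangentSpace 𝓘(ℝ, EP) p :=
  mpullback 𝓘(ℝ, EP) 𝓘(ℝ, EP) (fun q : P => MulOpposite.op g⁻¹ • q) X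

/-- The push-forward by `R_g` is defined as the pullback by `R_{g⁻¹}`, for which naturality of the
bracket is available. At `p · g` the pullback inverts the derivative of `R_{g⁻¹}`, which gives back
the derivative of `R_g` at `p`. -/
theorem IsSmoothPrincipalBundle.translateField_apply (hP : IsSmoothPrincipalBundle E EG G EP π)
    (g : G) (X : ∀ p : P, TangentSpace 𝓘(ℝ, EP) p) (p : P) :
    translateField EP g X (MulOpposite.op g • p) = rightTranslationDeriv EP g p (X p) := by
  have h : (X (MulOpposite.op g⁻¹ • MulOpposite.op g • p) : EP) = X p :=
    congrArg (fun q => (X q : EP)) (by simp)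
  exact (congrArg₂ (fun (L : EP →L[ℝ] EP) (w : EP) => L w) (hP.inverse_mfderiv_smul g p).1 h)

theorem IsSmoothPrincipalBundle.isSmoothVectorField_translateField
    (hP : IsSmoothPrincipalBundle E EG G EP π) (g : G) {X : ∀ p : P, TangentSpace 𝓘(ℝ, EP) p}
    (hX : IsSmoothVectorField X) : IsSmoothVectorField (translateField EP g X) := by
  refine ContMDiff.mpullback_vectorField (n := ∞) hX (hP.contMDiff_smul_left g⁻¹) (fun p => ?_)
    (by simp)
  have h := (hP.inverse_mfderiv_smul g (MulOpposite.op g⁻¹ • p)).2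
  rwa [smul_smul, ← MulOpposite.op_mul, inv_mul_cancel, MulOpposite.op_one, one_smul] at h

theorem IsFoliatedPrincipalBundle.isTangentField_translateField
    (hP : IsFoliatedPrincipalBundle EG G π FP F) (g : G) {Z : ∀ p : P, TangentSpace 𝓘(ℝ, EP) p}
    (hZ : FP.IsTangentField Z) : FP.IsTangentField (translateField EP g Z) := by
  refine ⟨hP.principal.isSmoothVectorField_translateField g hZ.1, fun p => ?_⟩
  obtain ⟨q, rfl⟩ : ∃ q, MulOpposite.op g • q = p := ⟨MulOpposite.op g⁻¹ • p, by simp⟩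
  rw [hP.principal.translateField_apply]
  exact hP.rightTranslationDeriv_mem g (hZ.2 q)

theorem IsSmoothPrincipalBundle.translateField_mlieBracket
    (hP : IsSmoothPrincipalBundle E EG G EP π) (g : G) {X Y : ∀ p : P, TangentSpace 𝓘(ℝ, EP) p}
    (hX : IsSmoothVectorField X) (hY : IsSmoothVectorField Y) (p : P) :
    translateField EP g (mlieBracket 𝓘(ℝ, EP) X Y) p =
      mlieBracket 𝓘(ℝ, EP) (translateField EP g X) (translateField EP g Y) p :=
  have : IsManifold 𝓘(ℝ, EP) (minSmoothness ℝ 2) P := .of_le (n := ∞) (by simp; decide)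
  mpullback_mlieBracket (n := ∞) (hX.mdifferentiableAt (by simp)) (hY.mdifferentiableAt (by simp))
    (hP.contMDiff_smul_left g⁻¹).contMDiffAt (by simp; decide)

/-- The identity `L_Z β = 0` at `p · g`, for the push-forwards of `Z` and `Y` by `R_g`, is
transported back to `p`. It applies because the push-forward of `Z` is still tangent to `FP`, and it
is compatible with brackets; `Ad(g)` is a fixed linear map. -/
theorem IsFoliatedPrincipalBundle.dirDeriv_conjForm (hP : IsFoliatedPrincipalBundle EG G π FP F)
    (hβ : ∀ X : ∀ p : P, TangentSpace 𝓘(ℝ, EP) p, IsSmoothVectorField X →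
      ContMDiff 𝓘(ℝ, EP) 𝓘(ℝ, EG) ∞ fun p => β p (X p))
    (hβ' : ∀ Z Y : ∀ p : P, TangentSpace 𝓘(ℝ, EP) p, FP.IsTangentField Z → IsSmoothVectorField Y →
      ∀ p, dirDeriv (fun q => β q (Y q)) p (Z p) = β p (mlieBracket 𝓘(ℝ, EP) Z Y p))
    {Z Y : ∀ p : P, TangentSpace 𝓘(ℝ, EP) p} (hZ : FP.IsTangentField Z)
    (hY : IsSmoothVectorField Y) (p : P) (g : G) :
    dirDeriv (fun q => conjForm G β q (Y q) g) p (Z p) =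
      conjForm G β p (mlieBracket 𝓘(ℝ, EP) Z Y p) g := by
  have hYg := hP.principal.isSmoothVectorField_translateField g hY
  have hfun : (fun q => conjForm G β q (Y q) g) = fun q => adjointMap EG g
      ((fun q => β q (translateField EP g Y q)) (MulOpposite.op g • q)) := by
    funext q
    simp only [conjForm]
    rw [hP.principal.translateField_apply]
  have hφ := (hβ _ hYg).mdifferentiableAt (x := MulOpposite.op g • p)
    (show (∞ : WithTop ℕ∞) ≠ 0 by simp)
  have hR := (hP.principal.contMDiff_smul_left g).mdifferentiableAt (x := p)
    (show (∞ : WithTop ℕ∞) ≠ 0 by simp)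
  rw [hfun, dirDeriv_clm (adjointMap EG g)
    (f := fun q => (fun q => β q (translateField EP g Y q)) (MulOpposite.op g • q))
    (hφ.comp p hR), conjForm]
  refine congrArg _ ((dirDeriv_comp hφ hR (Z p)).trans ?_)
  have h1 := hβ' _ _ (hP.isTangentField_translateField g hZ) hYg (MulOpposite.op g • p)
  rw [← hP.principal.translateField_mlieBracket g hZ.1 hY, hP.principal.translateField_apply,
    hP.principal.translateField_apply] at h1
  exact h1

variable [CompactSpace G] [MeasurableSpace G] [BorelSpace G] {μ : Measure G}
  [IsProbabilityMeasure μ] [μ.IsMulLeftInvariant]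

/-- The average of a one-form with values in the Lie algebra, as a principal connection. -/
def averageConnection [IsTopologicalGroup G] (μ : Measure G) [IsProbabilityMeasure μ]
    [μ.IsMulLeftInvariant]
    (hP : IsSmoothPrincipalBundle E EG G EP π)
    (hβ : ∀ X : ∀ p : P, TangentSpace 𝓘(ℝ, EP) p, IsSmoothVectorField X →
      ContMDiff 𝓘(ℝ, EP) 𝓘(ℝ, EG) ∞ fun p => β p (X p))
    (hβ' : ∀ p A, β p (fundamentalMap EG G EP p A) = A) : PrincipalConnection EG G EP P where
  form p :=
    { toFun := fun v => (∫ g, conjForm G β p v g ∂μ : EG)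
      map_add' := fun v w => by
        simp only [conjForm_add]
        exact integral_add (G := EG) (hP.continuous_conjForm hβ p v).integrable_of_compactSpace
          (hP.continuous_conjForm hβ p w).integrable_of_compactSpace
      map_smul' := fun c v => by
        simp only [conjForm_smul]
        exact integral_smul (G := EG) c _ }
  smooth X hX := ContMDiff.integral (hP.contMDiff_conjForm hβ hX)
  equivariant h p v := by
    have h1 : ∫ g, conjForm G β (MulOpposite.op h • p) (rightTranslationDeriv EP h p v) g ∂μ =
        ∫ g, adjointMap EG h⁻¹ (conjForm G β p v (h * g)) ∂μ :=
      integral_congr_ae (Eventually.of_forall fun g => hP.conjForm_rightTranslationDeriv h p v g)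
    -- Left invariance of the measure absorbs `h`; the constant operator `Ad(h⁻¹)` then leaves the
    -- integral.
    have h2 : ∫ g, adjointMap EG h⁻¹ (conjForm G β p v (h * g)) ∂μ =
        ∫ g, adjointMap EG h⁻¹ (conjForm G β p v g) ∂μ :=
      integral_mul_left_eq_self (fun g => adjointMap EG h⁻¹ (conjForm G β p v g)) h
    exact h1.trans (h2.trans ((adjointMap EG h⁻¹).integral_comp_comm
      (hP.continuous_conjForm hβ p v).integrable_of_compactSpace))
  fundamental A p := by
    have h (A : EG) : ∫ g, conjForm G β p (fundamentalMap EG G EP p A) g ∂μ = A := by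
      -- The integrand is constantly `A`, and the total mass is 1.
      simp only [hP.conjForm_fundamentalField hβ', integral_const, probReal_univ, one_smul]
    exact h A

theorem IsFoliatedPrincipalBundle.averageConnection_isBasic [IsTopologicalGroup G]
    (hP : IsFoliatedPrincipalBundle EG G π FP F)
    (hβ : ∀ X : ∀ p : P, TangentSpace 𝓘(ℝ, EP) p, IsSmoothVectorField X →
      ContMDiff 𝓘(ℝ, EP) 𝓘(ℝ, EG) ∞ fun p => β p (X p))
    (hβ₁ : ∀ p A, β p (fundamentalMap EG G EP p A) = A)
    (hβ₂ : ∀ p, ∀ v ∈ FP.tangent p, β p v = 0)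
    (hβ₃ : ∀ Z Y : ∀ p : P, TangentSpace 𝓘(ℝ, EP) p, FP.IsTangentField Z → IsSmoothVectorField Y →
      ∀ p, dirDeriv (fun q => β q (Y q)) p (Z p) = β p (mlieBracket 𝓘(ℝ, EP) Z Y p)) :
    (averageConnection μ hP.principal hβ hβ₁).IsBasic FP := by
  intro Z hZ
  have h0 : ∀ p, (averageConnection μ hP.principal hβ hβ₁).eval Z p = 0 := fun p =>
    integral_eq_zero_of_ae (G := EG)
      (Eventually.of_forall fun g => hP.conjForm_eq_zero hβ₂ (hZ.2 p) g)
  refine ⟨h0, fun Y hY p => ?_⟩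
  have h1 : dirDeriv ((averageConnection μ hP.principal hβ hβ₁).eval Y) p (Z p) =
      (averageConnection μ hP.principal hβ hβ₁).eval (mlieBracket 𝓘(ℝ, EP) Z Y) p :=
    (dirDeriv_integral (hP.principal.contMDiff_conjForm hβ hY) p (Z p)).trans
      (integral_congr_ae (Eventually.of_forall fun g => hP.dirDeriv_conjForm hβ hβ₃ hZ hY p g))
  rw [PrincipalConnection.extDeriv, h1, dirDeriv_eq_zero (Eventually.of_forall h0), sub_zero,
    sub_self]

end Averaging

end

/-- On a foliated principal bundle with compact structure group over a Riemannian foliation, there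
is a transverse Riemannian metric if and only if there is a basic connection. -/
theorem proposition6p3p1
    {E : Type*} [NormedAddCommGroup E] [NormedSpace ℝ E] [FiniteDimensional ℝ E]
    {M : Type*} [TopologicalSpace M] [T2Space M] [SigmaCompactSpace M]
    [ChartedSpace E M] [IsManifold 𝓘(ℝ, E) ∞ M]
    {EG : Type*} [NormedAddCommGroup EG] [NormedSpace ℝ EG] [FiniteDimensional ℝ EG]
    {G : Type*} [TopologicalSpace G] [T2Space G] [CompactSpace G]
    [ChartedSpace EG G] [Group G] [LieGroup 𝓘(ℝ, EG) ∞ G]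
    {EP : Type*} [NormedAddCommGroup EP] [NormedSpace ℝ EP] [FiniteDimensional ℝ EP]
    {P : Type*} [TopologicalSpace P] [T2Space P] [SigmaCompactSpace P]
    [ChartedSpace EP P] [IsManifold 𝓘(ℝ, EP) ∞ P] [MulAction Gᵐᵒᵖ P]
    (F : SmoothFoliation E M) (FP : SmoothFoliation EP P) (π : P → M)
    (hP : IsFoliatedPrincipalBundle EG G π FP F)
    (hF : F.IsRiemannian) :
    (∃ g : FP.NormalMetric, g.IsInvariant) ↔
      ∃ θ : PrincipalConnection EG G EP P, θ.IsBasic FP := by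
  constructor
  · rintro ⟨g, hg⟩
    have : IsTopologicalGroup G := topologicalGroup_of_lieGroup 𝓘(ℝ, EG) ∞
    let _ : MeasurableSpace G := borel G
    have : BorelSpace G := ⟨rfl⟩
    -- Haar measure normalized on the whole compact group, hence of total mass 1.
    let μ : MeasureTheory.Measure G := MeasureTheory.Measure.haarMeasure ⊤
    have : MeasureTheory.IsProbabilityMeasure μ :=
      ⟨MeasureTheory.Measure.haarMeasure_self (K₀ := ⊤)⟩
    exact ⟨_, hP.averageConnection_isBasic (μ := μ)
      (fun _ hX => g.contMDiff_basicForm hP hX)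
      (fun p A => g.basicForm_fundamentalField hP p A) (fun p _ hv => g.basicForm_eq_zero hv)
      (fun _ _ hZ hY p => hg.dirDeriv_basicForm hP hZ hY p)⟩
  · rintro ⟨θ, hθ⟩
    obtain ⟨gM, hgM⟩ := hF
    exact ⟨connectionMetric hP gM hθ, connectionMetric_isInvariant hP hgM hθ⟩
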